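/- Let $H$ be a connected (finite-dimensional real) Lie group acting smoothly from the left on a smooth Hausdorff manifold $M$, and let $H\ltimes M$ be the action groupoid over $M$: $s(g,x)=x$, $t(g,x)=gx$, $(g,hx)\cdot(h,x)=(gh,x)$. Let $\mathfrak h=T_1H$, let $\rho_x(v)=\frac{d}{dt}\big|_{0}\exp(tv)x$ be the infinitesimal action, and let $\mathfrak h\ltimes M$ be the Lie algebroid of $H\ltimes M$ (defined with right-invariant vector fields): the bundle $\mathfrak h_M=\mathfrak h\times M$ with anchor $\rho$ and bracket $[\alpha,\beta](x)=[\alpha(x),\beta(x)]_{\mathfrak h}+(\mathcal L_{\rho(\alpha)}\beta)(x)-(\mathcal L_{\rho(\beta)}\alpha)(x)$, where $[\cdot,\cdot]_{\mathfrak h}$ is the bracket of right-invariant vector fields. Let $\lambda_g(V)=(dL_{g^{-1}})_gV$ be the left-invariant Maurer–Cartan form of $H$. Let $\phi\in\Omega^3(M)$ be closed and $\rho^*:\mathfrak h_M\to T^*M$ a smooth bundle map such that for all sections $\alpha,\beta$ of $\mathfrak h_M$ $$\langle\rho^*(\beta),\rho(\alpha)\rangle=-\langle\rho^*(\alpha),\rho(\beta)\rangle,\qquad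 \rho^*([\alpha,\beta])=\mathcal L_{\rho(\alpha)}\rho^*(\beta)-\mathcal L_{\rho(\beta)}\rho^*(\alpha)-d\langle\rho^*(\beta),\rho(\alpha)\rangle+\phi(\rho(\alpha),\rho(\beta),\cdot).$$ Let $\omega=\omega_{\rho^*,\phi}\in\Omega^2(H\ltimes M)$ be the associated 2-form, i.e. $\omega$ is multiplicative ($m^*\omega=pr_1^*\omega+pr_2^*\omega$ on composable pairs), relatively $\phi$-closed ($d\omega=s^*\phi-t^*\phi$), and $\omega_{(1,x)}((v,0),(0,X))=\langle\rho^*_x(v),X\rangle$ for $v\in\mathfrak h$, $X\in T_xM$. Then the following are equivalent: (i) $\rho^*+\phi$ is an equivariantly closed element of $\Omega^3_H(M)=(\Omega^3(M)\oplus \mathfrak h^*\otimes\Omega^1(M))^H$; that is, $g^*(\rho^*(\mathrm{Ad}_gv))=\rho^*(v)$ and $g^*\phi=\phi$ for all $g\in H$, $v\in\mathfrak h$, and $d\phi=0$, $d(\rho^*(v))=i_{\rho(v)}\phi$, $i_{\rho(v)}\rho^*(v)=0$ for all $v\in\mathfrak h$; (ii) the restriction of $\omega$ to every slice $\{g\}\times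 M$, $g\in H$, vanishes; (iii) $\omega_{g,x}=\langle\rho^*_x\,pr_g^*\lambda,\ pr_x^*+\tfrac12\rho_x\,pr_g^*\lambda\rangle$ (pairing skew-symmetrised: $\langle a,b\rangle(Y,Y')=\langle a(Y),b(Y')\rangle-\langle a(Y'),b(Y)\rangle$); (iii') explicitly, for all $g\in H$, $x\in M$, $V,V'\in T_gH$, $X,X'\in T_xM$, $$\omega_{g,x}((V,X),(V',X'))=\langle\rho^*_x(\lambda_g(V)),\rho_x(\lambda_g(V'))\rangle+\langle\rho^*_x(\lambda_g(V)),X'\rangle-\langle\rho^*_x(\lambda_g(V')),X\rangle.$$ Moreover, every equivariantly closed $\rho^*+\phi\in\Omega^3_H(M)$ has exactly one associated 2-form $\omega_{\rho^*,\phi}$; it is given by the formula in (iii'), and $$[\rho^*+\phi]\longmapsto[\omega_{\rho^*,\phi}+\phi]$$ is a well-defined linear map from the degree-3 cohomology of the Cartan complex $(\Omega_H^\bullet(M),d_H)$, $(d_HP)(v)=d(P(v))-i_{\rho(v)}(P(v))$, to the degree-3 equivariant cohomology of $M$, computed by the total complex of the double complex $\Omega^p(H^q\times M)$ with differential $\delta+(-1)^qd$,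 $\delta=\sum_i(-1)^id_i^*$, where $d_i:H^{q}\times M\to H^{q-1}\times M$ are the face maps of the nerve of $H\ltimes M$. -/

import Mathlib

open scoped Manifold ContDiff

noncomputable section

/-! ## Differential forms on (boundaryless) manifolds -/

section Forms

variable {E : Type*} [NormedAddCommGroup E] [NormedSpace ℝ E]
  {K : Type*} [TopologicalSpace K]
  {F : Type*} [NormedAddCommGroup F] [NormedSpace ℝ F]
  {L : Type*} [TopologicalSpace L]

/-- A (not necessarily smooth) differential `k`-form on the manifold `M`: an alternating `k`-linear
form on each tangent space. Smoothness is the predicate `DForm.IsSmooth`. -/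
abbrev DForm (I : ModelWithCorners ℝ E K) (M : Type*) [TopologicalSpace M] [ChartedSpace K M]
    (k : ℕ) : Type _ :=
  (x : M) → TangentSpace I x [⋀^Fin k]→L[ℝ] ℝ

variable {I : ModelWithCorners ℝ E K} {M : Type*} [TopologicalSpace M] [ChartedSpace K M]
  {J : ModelWithCorners ℝ F L} {N : Type*} [TopologicalSpace N] [ChartedSpace L N]
  {k : ℕ}

/-- The coordinate expression of a form in the preferred chart at `x₀`: its pull-back under the
inverse of this chart. -/
def DForm.inChart (θ : DForm I M k) (x₀ : M) (y : E) : E [⋀^Fin k]→L[ℝ] ℝ :=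
  (θ ((extChartAt I x₀).symm y)).compContinuousLinearMap
    ((mfderiv 𝓘(ℝ, E) I (extChartAt I x₀).symm y).comp
      ((NormedSpace.fromTangentSpace (𝕜 := ℝ) y).symm : E →L[ℝ] TangentSpace 𝓘(ℝ, E) y))

/-- A form is smooth if all its coordinate expressions are. -/
def DForm.IsSmooth (θ : DForm I M k) : Prop :=
  ∀ x₀ : M, ContDiffOn ℝ ∞ (θ.inChart x₀) (extChartAt I x₀).target

/-- The exterior derivative, computed at `x` in the chart at `x`, with the convention
`dθ (X₀, …, Xₖ) = ∑ (-1)ⁱ Xᵢ (θ (…)) + …` (no normalising factor). -/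
def DForm.d (θ : DForm I M k) : DForm I M (k + 1) := fun x =>
  (extDeriv (θ.inChart x) (extChartAt I x x)).compContinuousLinearMap
    ((NormedSpace.fromTangentSpace (𝕜 := ℝ) (extChartAt I x x) :
        TangentSpace 𝓘(ℝ, E) (extChartAt I x x) →L[ℝ] E).comp
      (mfderiv I 𝓘(ℝ, E) (extChartAt I x) x))

/-- The pull-back `f^* θ`. -/
def DForm.pullback (I : ModelWithCorners ℝ E K) (J : ModelWithCorners ℝ F L)
    (f : M → N) (θ : DForm J N k) : DForm I M k := fun x =>
  (θ (f x)).compContinuousLinearMap (mfderiv I J f x)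

/-- The contraction `i_X θ = θ (X, ·, …, ·)` with a vector field. -/
def DForm.contract (X : (x : M) → TangentSpace I x) (θ : DForm I M (k + 1)) : DForm I M k :=
  fun x => ContinuousAlternatingMap.curryLeft (E := E) (θ x) (X x)

/-- The Lie derivative of a form of positive degree, by Cartan's formula. -/
def DForm.lieDeriv (X : (x : M) → TangentSpace I x) (θ : DForm I M (k + 1)) :
    DForm I M (k + 1) :=
  DForm.d (DForm.contract X θ) + DForm.contract X (DForm.d θ)

/-! Linearity of these operations (for `d`: on smooth forms). -/

theorem DForm.inChart_add (θ η : DForm I M k) (x₀ : M) :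
    DForm.inChart (θ + η) x₀ = θ.inChart x₀ + η.inChart x₀ := by
  funext y; ext v; rfl

theorem DForm.inChart_smul (c : ℝ) (θ : DForm I M k) (x₀ : M) :
    DForm.inChart (c • θ) x₀ = c • θ.inChart x₀ := by
  funext y; ext v; rfl

theorem DForm.inChart_zero (x₀ : M) : DForm.inChart (0 : DForm I M k) x₀ = 0 := by
  funext y; ext v; rfl

theorem DForm.isSmooth_zero : DForm.IsSmooth (0 : DForm I M k) := fun x₀ => by
  rw [DForm.inChart_zero]; exact contDiffOn_const

theorem DForm.IsSmooth.add {θ η : DForm I M k} (hθ : θ.IsSmooth) (hη : η.IsSmooth) :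
    DForm.IsSmooth (θ + η) := fun x₀ => by
  rw [DForm.inChart_add]; exact (hθ x₀).add (hη x₀)

theorem DForm.IsSmooth.smul (c : ℝ) {θ : DForm I M k} (hθ : θ.IsSmooth) :
    DForm.IsSmooth (c • θ) := fun x₀ => by
  rw [DForm.inChart_smul]; exact (hθ x₀).const_smul c

theorem DForm.IsSmooth.differentiableAt [I.Boundaryless] {θ : DForm I M k} (hθ : θ.IsSmooth)
    (x : M) : DifferentiableAt ℝ (θ.inChart x) (extChartAt I x x) :=
  ((hθ x).contDiffAt (extChartAt_target_mem_nhds x)).differentiableAt (by simp)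

theorem DForm.d_add [I.Boundaryless] {θ η : DForm I M k} (hθ : θ.IsSmooth) (hη : η.IsSmooth) :
    (θ + η).d = θ.d + η.d := by
  funext x
  simp only [DForm.d, DForm.inChart_add, Pi.add_apply]
  rw [extDeriv_add (hθ.differentiableAt x) (hη.differentiableAt x)]
  rfl

theorem DForm.d_smul (c : ℝ) (θ : DForm I M k) : (c • θ).d = c • θ.d := by
  funext x
  simp only [DForm.d, DForm.inChart_smul, Pi.smul_apply]
  rw [extDeriv_smul]
  rfl

theorem DForm.d_zero : DForm.d (0 : DForm I M k) = 0 := by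
  have h := DForm.d_smul (0 : ℝ) (0 : DForm I M k)
  simpa using h

theorem DForm.pullback_add (f : M → N) (θ η : DForm J N k) :
    DForm.pullback I J f (θ + η) = DForm.pullback I J f θ + DForm.pullback I J f η := by
  funext x; ext v; rfl

theorem DForm.pullback_smul (f : M → N) (c : ℝ) (θ : DForm J N k) :
    DForm.pullback I J f (c • θ) = c • DForm.pullback I J f θ := by
  funext x; ext v; rfl

theorem DForm.contract_add (X : (x : M) → TangentSpace I x) (θ η : DForm I M (k + 1)) :
    DForm.contract X (θ + η) = DForm.contract X θ + DForm.contract X η := by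
  funext x; ext v; rfl

theorem DForm.contract_smul (X : (x : M) → TangentSpace I x) (c : ℝ) (θ : DForm I M (k + 1)) :
    DForm.contract X (c • θ) = c • DForm.contract X θ := by
  funext x; ext v; rfl

/-- The tangent vector `(V, X)` of a product manifold. -/
def pairVec {g : M} {x : N} (V : TangentSpace I g) (X : TangentSpace J x) :
    TangentSpace (I.prod J) (g, x) :=
  ((V, X) : E × F)

end Forms

/-! ## Lie group actions

The acting Lie group `H` is called `G` below; its Lie algebra `𝔥` is `GroupLieAlgebra I G`. -/

section Action

variable {E : Type*} [NormedAddCommGroup E] [NormedSpace ℝ E]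
  {K : Type*} [TopologicalSpace K] {I : ModelWithCorners ℝ E K}
  {F : Type*} [NormedAddCommGroup F] [NormedSpace ℝ F]
  {L : Type*} [TopologicalSpace L] {J : ModelWithCorners ℝ F L}
  {G : Type*} [TopologicalSpace G] [ChartedSpace K G] [Group G]
  {M : Type*} [TopologicalSpace M] [ChartedSpace L M] [MulAction G M]
  {k : ℕ}

/-- The left-invariant Maurer-Cartan form `λ_g (V) = (dL_{g⁻¹})_g V`. -/
def maurerCartan (g : G) (V : TangentSpace I g) : GroupLieAlgebra I G :=
  (mfderiv I I (fun h : G => g⁻¹ * h) g V : TangentSpace I (g⁻¹ * g))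

/-- The adjoint representation, `Ad_g v = d(h ↦ g h g⁻¹)_1 v`. -/
def adjointAction (g : G) (v : GroupLieAlgebra I G) : GroupLieAlgebra I G :=
  (mfderiv I I (fun h : G => g * h * g⁻¹) 1 v : TangentSpace I (g * 1 * g⁻¹))

/-- The right-invariant vector field `g ↦ (dR_g)_1 v`. -/
def rightInvariantField (v : GroupLieAlgebra I G) (g : G) : TangentSpace I g :=
  (mfderiv I I (fun h : G => h * g) 1 v : TangentSpace I (1 * g))

/-- The Lie bracket on `𝔥` for which `𝔥` is the Lie algebroid of the group `H` viewed as a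
groupoid: Lie algebroids being defined with right-invariant vector fields, it is the bracket of
right-invariant vector fields, for which `infAction` is a morphism of Lie algebras. -/
def rightBracket (v w : GroupLieAlgebra I G) : GroupLieAlgebra I G :=
  VectorField.mlieBracket I (rightInvariantField v) (rightInvariantField w) (1 : G)

/-- The infinitesimal action `ρ_x (v) = d/dt (exp (t v) • x)` at `t = 0`, which is the anchor
`ρ = dt` of the action Lie algebroid `𝔥 ⋉ M`. -/
def infAction (I : ModelWithCorners ℝ E K) (J : ModelWithCorners ℝ F L)
    (v : GroupLieAlgebra I G) (x : M) : TangentSpace J x :=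
  (mfderiv I J (fun g : G => g • x) 1 v : TangentSpace J ((1 : G) • x))

/-- An element of `𝔥` as a vector of the model space `E`, by which `𝔥` is represented. -/
def asVector (v : GroupLieAlgebra I G) : E := v

/-- Smoothness of a section of the trivial bundle `𝔥_M = 𝔥 × M`, i.e. of a map `M → 𝔥`. -/
def IsSmoothSection (J : ModelWithCorners ℝ F L) (α : M → GroupLieAlgebra I G) : Prop :=
  ContMDiff J 𝓘(ℝ, E) ∞ (fun x => asVector (α x))

/-- The derivative of a map `α : M → 𝔥` along a tangent vector. -/
def sectionDeriv (α : M → GroupLieAlgebra I G) {x : M} (X : TangentSpace J x) :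
    GroupLieAlgebra I G :=
  NormedSpace.fromTangentSpace (𝕜 := ℝ) (asVector (α x))
    (mfderiv J 𝓘(ℝ, E) (fun y => asVector (α y)) x X)

/-- The vector field `ρ(α)`. -/
def anchor (J : ModelWithCorners ℝ F L) (α : M → GroupLieAlgebra I G) (x : M) :
    TangentSpace J x :=
  infAction I J (α x) x

/-- The bracket of sections of the action Lie algebroid `𝔥 ⋉ M`: the extension of the bracket of
constant sections by the Leibniz rule. -/
def algebroidBracket (J : ModelWithCorners ℝ F L) (α β : M → GroupLieAlgebra I G) (x : M) :
    GroupLieAlgebra I G :=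
  rightBracket (α x) (β x) + sectionDeriv (J := J) β (anchor J α x)
    - sectionDeriv (J := J) α (anchor J β x)

/-! A smooth bundle map `ρ^* : 𝔥_M → T^*M` is the same as a linear map
`ρs : 𝔥 → Ω¹(M)` with smooth values: `ρ^*_x (v) = ρs v x`. -/

/-- The one-form `ρ^*(α)` for a section `α` of `𝔥_M`. -/
def applySection (ρs : GroupLieAlgebra I G →ₗ[ℝ] DForm J M 1) (α : M → GroupLieAlgebra I G) :
    DForm J M 1 :=
  fun x => ρs (α x) x

/-- `⟨ρ^*(β), ρ(α)⟩ = - ⟨ρ^*(α), ρ(β)⟩` for all sections. -/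
def SkewCondition (ρs : GroupLieAlgebra I G →ₗ[ℝ] DForm J M 1) : Prop :=
  ∀ α β : M → GroupLieAlgebra I G, IsSmoothSection J α → IsSmoothSection J β →
    DForm.contract (anchor J α) (applySection ρs β)
      = - DForm.contract (anchor J β) (applySection ρs α)

/-- `ρ^*([α, β]) = L_α (ρ^*(β)) - L_β (ρ^*(α)) - d⟨ρ^*(β), ρ(α)⟩ + φ(ρ(α), ρ(β), ·)` for all
sections. -/
def BracketCondition (ρs : GroupLieAlgebra I G →ₗ[ℝ] DForm J M 1) (φ : DForm J M 3) : Prop :=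
  ∀ α β : M → GroupLieAlgebra I G, IsSmoothSection J α → IsSmoothSection J β →
    applySection ρs (algebroidBracket J α β)
      = DForm.lieDeriv (anchor J α) (applySection ρs β)
        - DForm.lieDeriv (anchor J β) (applySection ρs α)
        - DForm.d (DForm.contract (anchor J α) (applySection ρs β))
        + DForm.contract (anchor J β) (DForm.contract (anchor J α) φ)

/-! ## The nerve of the action groupoid `H ⋉ M`

Its space of strings of `q` composable arrows is `H^q × M`, the element `(g₁, …, g_q, x)` standing
for the arrows `(g₁, g₂⋯g_q x), …, (g_{q-1}, g_q x), (g_q, x)`. The face maps are listed below. For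
`q = 1`: source and target; for `q = 2`: second projection, multiplication, first projection. -/

/-- Source `s (g, x) = x`. -/
def actSource (p : G × M) : M := p.2

/-- Target `t (g, x) = g x`. -/
def actTarget (p : G × M) : M := p.1 • p.2

/-- The second of two composable arrows. -/
def actPr₂ (p : G × G × M) : G × M := (p.2.1, p.2.2)

/-- The product of two composable arrows `(g, h x)` and `(h, x)`, namely `(g h, x)`. -/
def actMul (p : G × G × M) : G × M := (p.1 * p.2.1, p.2.2)

/-- The first of two composable arrows. -/
def actPr₁ (p : G × G × M) : G × M := (p.1, p.2.1 • p.2.2)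

/-- The face maps of `(g, h, k, x)`. -/
def face₃ (i : Fin 4) (p : G × G × G × M) : G × G × M :=
  match i with
  | 0 => (p.2.1, p.2.2.1, p.2.2.2)
  | 1 => (p.1 * p.2.1, p.2.2.1, p.2.2.2)
  | 2 => (p.1, p.2.1 * p.2.2.1, p.2.2.2)
  | 3 => (p.1, p.2.1, p.2.2.1 • p.2.2.2)

/-- The face maps of `(g, h, k, l, x)`. -/
def face₄ (i : Fin 5) (p : G × G × G × G × M) : G × G × G × M :=
  match i with
  | 0 => (p.2.1, p.2.2.1, p.2.2.2.1, p.2.2.2.2)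
  | 1 => (p.1 * p.2.1, p.2.2.1, p.2.2.2.1, p.2.2.2.2)
  | 2 => (p.1, p.2.1 * p.2.2.1, p.2.2.2.1, p.2.2.2.2)
  | 3 => (p.1, p.2.1, p.2.2.1 * p.2.2.2.1, p.2.2.2.2)
  | 4 => (p.1, p.2.1, p.2.2.1, p.2.2.2.1 • p.2.2.2.2)

/-- `m^* θ = pr₁^* θ + pr₂^* θ` on pairs of composable arrows. -/
def IsMultiplicative (θ : DForm (I.prod J) (G × M) k) : Prop :=
  DForm.pullback (I.prod (I.prod J)) (I.prod J) (actMul (G := G) (M := M)) θ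
    = DForm.pullback (I.prod (I.prod J)) (I.prod J) (actPr₁ (G := G) (M := M)) θ
      + DForm.pullback (I.prod (I.prod J)) (I.prod J) (actPr₂ (G := G) (M := M)) θ

/-- `θ` is the multiplicative two-form `θ_{ρ^*, φ}` on `H ⋉ M` associated with `(ρ^*, φ)`: a smooth
multiplicative form which is relatively `φ`-closed and such that
`⟨ρ^*(v), X⟩ = θ((v, 0), (0, X))` at the units. -/
structure IsAssociatedForm (ρs : GroupLieAlgebra I G →ₗ[ℝ] DForm J M 1) (φ : DForm J M 3)
    (θ : DForm (I.prod J) (G × M) 2) : Prop where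
  smooth : θ.IsSmooth
  multiplicative : IsMultiplicative θ
  relClosed : θ.d = DForm.pullback (I.prod J) J (actSource (G := G) (M := M)) φ
    - DForm.pullback (I.prod J) J (actTarget (G := G) (M := M)) φ
  atUnits : ∀ (x : M) (v : GroupLieAlgebra I G) (X : TangentSpace J x),
    θ ((1 : G), x) ![pairVec (g := (1 : G)) (x := x) v 0, pairVec (g := (1 : G)) (x := x) 0 X]
      = ρs v x ![X]

/-- The restriction of `θ` to every slice `{g} × M` vanishes. -/
def VanishesOnSlices (θ : DForm (I.prod J) (G × M) k) : Prop :=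
  ∀ g : G, DForm.pullback J (I.prod J) (fun x : M => (g, x)) θ = 0

/-- `θ((V, X), (V', X')) = ⟨ρ^*λV, ρλV'⟩ + ⟨ρ^*λV, X'⟩ - ⟨ρ^*λV', X⟩`. -/
def HasExplicitFormula (ρs : GroupLieAlgebra I G →ₗ[ℝ] DForm J M 1)
    (θ : DForm (I.prod J) (G × M) 2) : Prop :=
  ∀ (g : G) (x : M) (V V' : TangentSpace I g) (X X' : TangentSpace J x),
    θ (g, x) ![pairVec V X, pairVec V' X']
      = ρs (maurerCartan g V) x ![infAction I J (maurerCartan g V') x]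
        + ρs (maurerCartan g V) x ![X'] - ρs (maurerCartan g V') x ![X]

/-- `θ = ⟨ρ^* pr_g^*λ, pr_x^* + ½ ρ pr_g^*λ⟩`, where the pairing of a `T^*M`-valued and a `TM`-valued
one-form is skew-symmetrised: `⟨a, b⟩(Y, Y') = ⟨a(Y), b(Y')⟩ - ⟨a(Y'), b(Y)⟩`. -/
def HasCompactFormula (ρs : GroupLieAlgebra I G →ₗ[ℝ] DForm J M 1)
    (θ : DForm (I.prod J) (G × M) 2) : Prop :=
  ∀ (g : G) (x : M) (V V' : TangentSpace I g) (X X' : TangentSpace J x),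
    θ (g, x) ![pairVec V X, pairVec V' X']
      = ρs (maurerCartan g V) x ![X' + (1 / 2 : ℝ) • infAction I J (maurerCartan g V') x]
        - ρs (maurerCartan g V') x ![X + (1 / 2 : ℝ) • infAction I J (maurerCartan g V) x]

/-! ## The Cartan complex in degrees two and three -/

/-- Invariance `g^*(P(Ad_g v)) = P(v)` of a linear form-valued polynomial on `𝔥`. -/
def IsInvariantLinear (P : GroupLieAlgebra I G →ₗ[ℝ] DForm J M k) : Prop :=
  ∀ (g : G) (v : GroupLieAlgebra I G),
    DForm.pullback J J (fun x : M => g • x) (P (adjointAction g v)) = P v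

variable (G) in
/-- Invariance `g^* β = β` of a form. -/
def IsInvariantForm (β : DForm J M k) : Prop :=
  ∀ g : G, DForm.pullback J J (fun x : M => g • x) β = β

variable (I J G M) in
/-- Underlying space of `(𝔥^* ⊗ Ω⁰(M)) ⊕ Ω²(M)`. -/
abbrev CartanCochain₂ : Type _ := (GroupLieAlgebra I G →ₗ[ℝ] DForm J M 0) × DForm J M 2

variable (I J G M) in
/-- Underlying space of `(𝔥^* ⊗ Ω¹(M)) ⊕ Ω³(M)`; the pair `(ρ^*, φ)` is the polynomial
`v ↦ ρ^*(v) + φ`. -/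
def CartanCochain₃ : Type _ := (GroupLieAlgebra I G →ₗ[ℝ] DForm J M 1) × DForm J M 3

instance : AddCommGroup (CartanCochain₃ I J G M) :=
  inferInstanceAs (AddCommGroup ((GroupLieAlgebra I G →ₗ[ℝ] DForm J M 1) × DForm J M 3))

instance : Module ℝ (CartanCochain₃ I J G M) :=
  inferInstanceAs (Module ℝ ((GroupLieAlgebra I G →ₗ[ℝ] DForm J M 1) × DForm J M 3))

/-- Smooth and invariant pairs: elements of `Ω²_H(M)`. -/
structure IsCartanForm₂ (b : CartanCochain₂ I J G M) : Prop where
  smooth_lin : ∀ v, DForm.IsSmooth (b.1 v)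
  smooth_const : DForm.IsSmooth b.2
  inv_lin : IsInvariantLinear b.1
  inv_const : IsInvariantForm G b.2

/-- Smooth and invariant pairs: elements of `Ω³_H(M)`. -/
structure IsCartanForm₃ (c : CartanCochain₃ I J G M) : Prop where
  smooth_lin : ∀ v, DForm.IsSmooth (c.1 v)
  smooth_const : DForm.IsSmooth c.2
  inv_lin : IsInvariantLinear c.1
  inv_const : IsInvariantForm G c.2

/-- `(d_H b)(v) = d(b(v)) - i_v(b(v))`, split into its components of form-degree 1 and 3. -/
def cartanD₂ (b : CartanCochain₂ I J G M) (v : GroupLieAlgebra I G) :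
    DForm J M 1 × DForm J M 3 :=
  (DForm.d (b.1 v) - DForm.contract (infAction I J v) b.2, DForm.d b.2)

/-- `(d_H c)(v) = d(c(v)) - i_v(c(v))`, split into its components of form-degree 0, 2 and 4. -/
def cartanD₃ (c : CartanCochain₃ I J G M) (v : GroupLieAlgebra I G) :
    DForm J M 0 × DForm J M 2 × DForm J M 4 :=
  (- DForm.contract (infAction I J v) (c.1 v),
    DForm.d (c.1 v) - DForm.contract (infAction I J v) c.2, DForm.d c.2)

section CartanLinear

theorem IsCartanForm₂.add {b b' : CartanCochain₂ I J G M} (h : IsCartanForm₂ b)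
    (h' : IsCartanForm₂ b') : IsCartanForm₂ (b + b') where
  smooth_lin v := (h.smooth_lin v).add (h'.smooth_lin v)
  smooth_const := h.smooth_const.add h'.smooth_const
  inv_lin g v := by
    simp only [Prod.fst_add, LinearMap.add_apply, DForm.pullback_add]
    rw [h.inv_lin, h'.inv_lin]
  inv_const g := by
    simp only [Prod.snd_add, DForm.pullback_add]
    rw [h.inv_const, h'.inv_const]

theorem IsCartanForm₂.smul (r : ℝ) {b : CartanCochain₂ I J G M} (h : IsCartanForm₂ b) :
    IsCartanForm₂ (r • b) where
  smooth_lin v := (h.smooth_lin v).smul r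
  smooth_const := h.smooth_const.smul r
  inv_lin g v := by
    simp only [Prod.smul_fst, LinearMap.smul_apply, DForm.pullback_smul]
    rw [h.inv_lin]
  inv_const g := by
    simp only [Prod.smul_snd, DForm.pullback_smul]
    rw [h.inv_const]

theorem isCartanForm₂_zero : IsCartanForm₂ (0 : CartanCochain₂ I J G M) where
  smooth_lin v := DForm.isSmooth_zero
  smooth_const := DForm.isSmooth_zero
  inv_lin g v := by funext x; ext w; rfl
  inv_const g := by funext x; ext w; rfl

theorem IsCartanForm₃.add {b b' : CartanCochain₃ I J G M} (h : IsCartanForm₃ b)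
    (h' : IsCartanForm₃ b') : IsCartanForm₃ (b + b') where
  smooth_lin v := (h.smooth_lin v).add (h'.smooth_lin v)
  smooth_const := h.smooth_const.add h'.smooth_const
  inv_lin g v := by
    change DForm.pullback J J _ (b.1 _ + b'.1 _) = b.1 v + b'.1 v
    rw [DForm.pullback_add, h.inv_lin, h'.inv_lin]
  inv_const g := by
    change DForm.pullback J J _ (b.2 + b'.2) = b.2 + b'.2
    rw [DForm.pullback_add, h.inv_const, h'.inv_const]

theorem IsCartanForm₃.smul (r : ℝ) {b : CartanCochain₃ I J G M} (h : IsCartanForm₃ b) :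
    IsCartanForm₃ (r • b) where
  smooth_lin v := (h.smooth_lin v).smul r
  smooth_const := h.smooth_const.smul r
  inv_lin g v := by
    change DForm.pullback J J _ (r • b.1 _) = r • b.1 v
    rw [DForm.pullback_smul, h.inv_lin]
  inv_const g := by
    change DForm.pullback J J _ (r • b.2) = r • b.2
    rw [DForm.pullback_smul, h.inv_const]

theorem isCartanForm₃_zero : IsCartanForm₃ (0 : CartanCochain₃ I J G M) where
  smooth_lin v := DForm.isSmooth_zero
  smooth_const := DForm.isSmooth_zero
  inv_lin g v := by funext x; ext w; rfl
  inv_const g := by funext x; ext w; rfl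

theorem DForm.contract_zero (X : (x : M) → TangentSpace J x) :
    DForm.contract X (0 : DForm J M (k + 1)) = 0 := by
  have h := DForm.contract_smul X (0 : ℝ) (0 : DForm J M (k + 1))
  simpa using h

theorem cartanD₂_add [J.Boundaryless] {b b' : CartanCochain₂ I J G M} (h : IsCartanForm₂ b)
    (h' : IsCartanForm₂ b') (v : GroupLieAlgebra I G) :
    cartanD₂ (b + b') v = cartanD₂ b v + cartanD₂ b' v := by
  simp only [cartanD₂, Prod.fst_add, Prod.snd_add, LinearMap.add_apply, DForm.contract_add,
    DForm.d_add (h.smooth_lin v) (h'.smooth_lin v), DForm.d_add h.smooth_const h'.smooth_const,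
    Prod.mk_add_mk]
  congr 1
  abel

theorem cartanD₂_smul (r : ℝ) (b : CartanCochain₂ I J G M) (v : GroupLieAlgebra I G) :
    cartanD₂ (r • b) v = r • cartanD₂ b v := by
  simp only [cartanD₂, Prod.smul_fst, Prod.smul_snd, LinearMap.smul_apply, DForm.contract_smul,
    DForm.d_smul, Prod.smul_mk, smul_sub]

theorem cartanD₃_add [J.Boundaryless] {b b' : CartanCochain₃ I J G M} (h : IsCartanForm₃ b)
    (h' : IsCartanForm₃ b') (v : GroupLieAlgebra I G) :
    cartanD₃ (b + b') v = cartanD₃ b v + cartanD₃ b' v := by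
  have h₁ : (b + b').1 v = b.1 v + b'.1 v := rfl
  have h₂ : (b + b').2 = b.2 + b'.2 := rfl
  simp only [cartanD₃, h₁, h₂, DForm.contract_add,
    DForm.d_add (h.smooth_lin v) (h'.smooth_lin v), DForm.d_add h.smooth_const h'.smooth_const,
    Prod.mk_add_mk]
  congr 1
  · abel
  · congr 1
    abel

theorem cartanD₃_smul (r : ℝ) (b : CartanCochain₃ I J G M) (v : GroupLieAlgebra I G) :
    cartanD₃ (r • b) v = r • cartanD₃ b v := by
  have h₁ : (r • b).1 v = r • b.1 v := rfl
  have h₂ : (r • b).2 = r • b.2 := rfl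
  simp only [cartanD₃, h₁, h₂, DForm.contract_smul,
    DForm.d_smul, Prod.smul_mk, smul_sub, smul_neg]

end CartanLinear

variable (I J G M) in
/-- The space of equivariantly closed three-forms `ρ^* + φ ∈ Ω³_H(M)`. -/
def cartanCocycles₃ [J.Boundaryless] : Submodule ℝ (CartanCochain₃ I J G M) where
  carrier := {c | IsCartanForm₃ c ∧ ∀ v, cartanD₃ c v = 0}
  zero_mem' := ⟨isCartanForm₃_zero, fun v => by
    have h := cartanD₃_smul (0 : ℝ) (0 : CartanCochain₃ I J G M) v
    simpa using h⟩
  add_mem' := fun {a b} ha hb => ⟨ha.1.add hb.1, fun v => by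
    rw [cartanD₃_add ha.1 hb.1, ha.2, hb.2, add_zero]⟩
  smul_mem' := fun r a ha => ⟨ha.1.smul r, fun v => by
    rw [cartanD₃_smul, ha.2, smul_zero]⟩

variable (I J G M) in
/-- The exact ones among them. -/
def cartanCoboundaries₃ [J.Boundaryless] : Submodule ℝ (cartanCocycles₃ I J G M) where
  carrier := {c | ∃ b : CartanCochain₂ I J G M, IsCartanForm₂ b ∧
    ∀ v, cartanD₂ b v = (c.1.1 v, c.1.2)}
  zero_mem' := ⟨0, isCartanForm₂_zero, fun v => by
    have h := cartanD₂_smul (0 : ℝ) (0 : CartanCochain₂ I J G M) v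
    rw [zero_smul, zero_smul] at h
    exact h⟩
  add_mem' := by
    rintro a a' ⟨b, hb, h⟩ ⟨b', hb', h'⟩
    refine ⟨b + b', hb.add hb', fun v => ?_⟩
    rw [cartanD₂_add hb hb', h, h']
    rfl
  smul_mem' := by
    rintro r a ⟨b, hb, h⟩
    refine ⟨r • b, hb.smul r, fun v => ?_⟩
    rw [cartanD₂_smul, h]
    rfl

variable (I J G M) in
/-- The degree three cohomology of the Cartan complex. -/
abbrev CartanH₃ [J.Boundaryless] : Type _ := cartanCocycles₃ I J G M ⧸ cartanCoboundaries₃ I J G M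

/-! ## Equivariant cohomology in degree three

The equivariant cohomology of `M` is the cohomology of the total complex of the double complex
`Ω^p(H^q × M)`, with the simplicial differential `δ = ∑ (-1)ⁱ dᵢ^*` and the de Rham differential `d`;
the total differential is `δ + (-1)^q d`. -/

/-- `δ : Ω^k(M) → Ω^k(H × M)`. -/
def simpD₀ (I : ModelWithCorners ℝ E K) (G : Type*) [TopologicalSpace G] [ChartedSpace K G]
    [Group G] [MulAction G M] (a : DForm J M k) : DForm (I.prod J) (G × M) k :=
  DForm.pullback (I.prod J) J (actSource (G := G) (M := M)) a
    - DForm.pullback (I.prod J) J (actTarget (G := G) (M := M)) a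

/-- `δ : Ω^k(H × M) → Ω^k(H² × M)`. -/
def simpD₁ (a : DForm (I.prod J) (G × M) k) : DForm (I.prod (I.prod J)) (G × G × M) k :=
  DForm.pullback (I.prod (I.prod J)) (I.prod J) (actPr₂ (G := G) (M := M)) a
    - DForm.pullback (I.prod (I.prod J)) (I.prod J) (actMul (G := G) (M := M)) a
    + DForm.pullback (I.prod (I.prod J)) (I.prod J) (actPr₁ (G := G) (M := M)) a

/-- `δ : Ω^k(H² × M) → Ω^k(H³ × M)`. -/
def simpD₂ (a : DForm (I.prod (I.prod J)) (G × G × M) k) :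
    DForm (I.prod (I.prod (I.prod J))) (G × G × G × M) k :=
  ∑ i : Fin 4, (-1 : ℝ) ^ (i : ℕ) •
    DForm.pullback (I.prod (I.prod (I.prod J))) (I.prod (I.prod J)) (face₃ i) a

/-- `δ : Ω^k(H³ × M) → Ω^k(H⁴ × M)`. -/
def simpD₃ (a : DForm (I.prod (I.prod (I.prod J))) (G × G × G × M) k) :
    DForm (I.prod (I.prod (I.prod (I.prod J)))) (G × G × G × G × M) k :=
  ∑ i : Fin 5, (-1 : ℝ) ^ (i : ℕ) •
    DForm.pullback (I.prod (I.prod (I.prod (I.prod J)))) (I.prod (I.prod (I.prod J))) (face₄ i) a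

section SimpLinear

theorem simpD₀_add (a b : DForm J M k) : simpD₀ I G (a + b) = simpD₀ I G a + simpD₀ I G b := by
  simp only [simpD₀, DForm.pullback_add]; abel

theorem simpD₀_smul (r : ℝ) (a : DForm J M k) : simpD₀ I G (r • a) = r • simpD₀ I G a := by
  simp only [simpD₀, DForm.pullback_smul, smul_sub]

theorem simpD₁_add (a b : DForm (I.prod J) (G × M) k) :
    simpD₁ (a + b) = simpD₁ a + simpD₁ b := by
  simp only [simpD₁, DForm.pullback_add]; abel

theorem simpD₁_smul (r : ℝ) (a : DForm (I.prod J) (G × M) k) :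
    simpD₁ (r • a) = r • simpD₁ a := by
  simp only [simpD₁, DForm.pullback_smul, smul_sub, smul_add]

theorem simpD₂_add (a b : DForm (I.prod (I.prod J)) (G × G × M) k) :
    simpD₂ (a + b) = simpD₂ a + simpD₂ b := by
  simp only [simpD₂, DForm.pullback_add, smul_add, Finset.sum_add_distrib]

theorem simpD₂_smul (r : ℝ) (a : DForm (I.prod (I.prod J)) (G × G × M) k) :
    simpD₂ (r • a) = r • simpD₂ a := by
  simp only [simpD₂, DForm.pullback_smul, Finset.smul_sum, smul_comm r]

theorem simpD₃_add (a b : DForm (I.prod (I.prod (I.prod J))) (G × G × G × M) k) :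
    simpD₃ (a + b) = simpD₃ a + simpD₃ b := by
  simp only [simpD₃, DForm.pullback_add, smul_add, Finset.sum_add_distrib]

theorem simpD₃_smul (r : ℝ) (a : DForm (I.prod (I.prod (I.prod J))) (G × G × G × M) k) :
    simpD₃ (r • a) = r • simpD₃ a := by
  simp only [simpD₃, DForm.pullback_smul, Finset.smul_sum, smul_comm r]

end SimpLinear

variable (I J G M) in
/-- Underlying space of `Ω²(M) ⊕ Ω¹(H × M) ⊕ Ω⁰(H² × M)`. -/
abbrev TotCochain₂ : Type _ :=
  DForm J M 2 × DForm (I.prod J) (G × M) 1 × DForm (I.prod (I.prod J)) (G × G × M) 0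

variable (I J G M) in
/-- Underlying space of `Ω³(M) ⊕ Ω²(H × M) ⊕ Ω¹(H² × M) ⊕ Ω⁰(H³ × M)`. -/
def TotCochain₃ : Type _ :=
  DForm J M 3 × DForm (I.prod J) (G × M) 2 × DForm (I.prod (I.prod J)) (G × G × M) 1 ×
    DForm (I.prod (I.prod (I.prod J))) (G × G × G × M) 0

instance : AddCommGroup (TotCochain₃ I J G M) :=
  inferInstanceAs (AddCommGroup
    (DForm J M 3 × DForm (I.prod J) (G × M) 2 × DForm (I.prod (I.prod J)) (G × G × M) 1 ×
      DForm (I.prod (I.prod (I.prod J))) (G × G × G × M) 0))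

instance : Module ℝ (TotCochain₃ I J G M) :=
  inferInstanceAs (Module ℝ
    (DForm J M 3 × DForm (I.prod J) (G × M) 2 × DForm (I.prod (I.prod J)) (G × G × M) 1 ×
      DForm (I.prod (I.prod (I.prod J))) (G × G × G × M) 0))

variable (I J G M) in
/-- Underlying space of `Ω⁴(M) ⊕ Ω³(H × M) ⊕ Ω²(H² × M) ⊕ Ω¹(H³ × M) ⊕ Ω⁰(H⁴ × M)`. -/
abbrev TotCochain₄ : Type _ :=
  DForm J M 4 × DForm (I.prod J) (G × M) 3 × DForm (I.prod (I.prod J)) (G × G × M) 2 ×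
    DForm (I.prod (I.prod (I.prod J))) (G × G × G × M) 1 ×
    DForm (I.prod (I.prod (I.prod (I.prod J)))) (G × G × G × G × M) 0

/-- Smoothness of all components. -/
def TotCochain₂.IsSmooth (b : TotCochain₂ I J G M) : Prop :=
  DForm.IsSmooth b.1 ∧ DForm.IsSmooth b.2.1 ∧ DForm.IsSmooth b.2.2

/-- Smoothness of all components. -/
def TotCochain₃.IsSmooth (a : TotCochain₃ I J G M) : Prop :=
  DForm.IsSmooth a.1 ∧ DForm.IsSmooth a.2.1 ∧ DForm.IsSmooth a.2.2.1 ∧ DForm.IsSmooth a.2.2.2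

/-- The total differential from degree two to degree three. -/
def totD₂ (b : TotCochain₂ I J G M) : TotCochain₃ I J G M :=
  (DForm.d b.1, simpD₀ I G b.1 - DForm.d b.2.1, simpD₁ b.2.1 + DForm.d b.2.2, simpD₂ b.2.2)

/-- The total differential from degree three to degree four. -/
def totD₃ (a : TotCochain₃ I J G M) : TotCochain₄ I J G M :=
  (DForm.d a.1, simpD₀ I G a.1 - DForm.d a.2.1, simpD₁ a.2.1 + DForm.d a.2.2.1,
    simpD₂ a.2.2.1 - DForm.d a.2.2.2, simpD₃ a.2.2.2)

section TotLinear

set_option linter.unusedSectionVars false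

theorem TotCochain₂.IsSmooth.add {a b : TotCochain₂ I J G M} (ha : TotCochain₂.IsSmooth a)
    (hb : TotCochain₂.IsSmooth b) : TotCochain₂.IsSmooth (a + b) :=
  ⟨ha.1.add hb.1, ha.2.1.add hb.2.1, ha.2.2.add hb.2.2⟩

theorem TotCochain₂.IsSmooth.smul (r : ℝ) {a : TotCochain₂ I J G M}
    (ha : TotCochain₂.IsSmooth a) : TotCochain₂.IsSmooth (r • a) :=
  ⟨ha.1.smul r, ha.2.1.smul r, ha.2.2.smul r⟩

theorem TotCochain₃.IsSmooth.add {a b : TotCochain₃ I J G M} (ha : TotCochain₃.IsSmooth a)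
    (hb : TotCochain₃.IsSmooth b) : TotCochain₃.IsSmooth (a + b) :=
  ⟨ha.1.add hb.1, ha.2.1.add hb.2.1, ha.2.2.1.add hb.2.2.1, ha.2.2.2.add hb.2.2.2⟩

theorem TotCochain₃.IsSmooth.smul (r : ℝ) {a : TotCochain₃ I J G M}
    (ha : TotCochain₃.IsSmooth a) : TotCochain₃.IsSmooth (r • a) :=
  ⟨ha.1.smul r, ha.2.1.smul r, ha.2.2.1.smul r, ha.2.2.2.smul r⟩

theorem totD₂_add [I.Boundaryless] [J.Boundaryless] {a b : TotCochain₂ I J G M}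
    (ha : TotCochain₂.IsSmooth a) (hb : TotCochain₂.IsSmooth b) :
    totD₂ (a + b) = totD₂ a + totD₂ b := by
  have h₁ : (totD₂ a + totD₂ b) = (DForm.d a.1 + DForm.d b.1,
    simpD₀ I G a.1 - DForm.d a.2.1 + (simpD₀ I G b.1 - DForm.d b.2.1),
    simpD₁ a.2.1 + DForm.d a.2.2 + (simpD₁ b.2.1 + DForm.d b.2.2),
    simpD₂ a.2.2 + simpD₂ b.2.2) := rfl
  rw [h₁]
  simp only [totD₂, Prod.fst_add, Prod.snd_add, simpD₀_add, simpD₁_add, simpD₂_add,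
    DForm.d_add ha.1 hb.1, DForm.d_add ha.2.1 hb.2.1, DForm.d_add ha.2.2 hb.2.2]
  congr 2
  · abel
  · congr 1
    abel

theorem totD₂_smul (r : ℝ) (a : TotCochain₂ I J G M) : totD₂ (r • a) = r • totD₂ a := by
  have h₁ : r • totD₂ a = (r • DForm.d a.1, r • (simpD₀ I G a.1 - DForm.d a.2.1),
    r • (simpD₁ a.2.1 + DForm.d a.2.2), r • simpD₂ a.2.2) := rfl
  rw [h₁]
  simp only [totD₂, Prod.smul_fst, Prod.smul_snd, simpD₀_smul, simpD₁_smul, simpD₂_smul,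
    DForm.d_smul, smul_sub, smul_add]
  rfl

theorem totD₃_add [I.Boundaryless] [J.Boundaryless] {a b : TotCochain₃ I J G M}
    (ha : TotCochain₃.IsSmooth a) (hb : TotCochain₃.IsSmooth b) :
    totD₃ (a + b) = totD₃ a + totD₃ b := by
  have h₁ : (a + b).1 = a.1 + b.1 := rfl
  have h₂ : (a + b).2.1 = a.2.1 + b.2.1 := rfl
  have h₃ : (a + b).2.2.1 = a.2.2.1 + b.2.2.1 := rfl
  have h₄ : (a + b).2.2.2 = a.2.2.2 + b.2.2.2 := rfl
  simp only [totD₃, h₁, h₂, h₃, h₄, simpD₀_add, simpD₁_add, simpD₂_add, simpD₃_add,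
    DForm.d_add ha.1 hb.1, DForm.d_add ha.2.1 hb.2.1, DForm.d_add ha.2.2.1 hb.2.2.1,
    DForm.d_add ha.2.2.2 hb.2.2.2, Prod.mk_add_mk]
  congr 2
  · abel
  · congr 1
    · abel
    · congr 1
      abel

theorem totD₃_smul (r : ℝ) (a : TotCochain₃ I J G M) : totD₃ (r • a) = r • totD₃ a := by
  have h₁ : (r • a).1 = r • a.1 := rfl
  have h₂ : (r • a).2.1 = r • a.2.1 := rfl
  have h₃ : (r • a).2.2.1 = r • a.2.2.1 := rfl
  have h₄ : (r • a).2.2.2 = r • a.2.2.2 := rfl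
  simp only [totD₃, h₁, h₂, h₃, h₄, simpD₀_smul, simpD₁_smul, simpD₂_smul,
    simpD₃_smul, DForm.d_smul, Prod.smul_mk, smul_sub, smul_add]

end TotLinear

variable (I J G M) in
/-- Smooth three-cocycles of the total complex. -/
def totCocycles₃ [I.Boundaryless] [J.Boundaryless] : Submodule ℝ (TotCochain₃ I J G M) where
  carrier := {a | TotCochain₃.IsSmooth a ∧ totD₃ a = 0}
  zero_mem' := ⟨⟨DForm.isSmooth_zero, DForm.isSmooth_zero, DForm.isSmooth_zero,
    DForm.isSmooth_zero⟩, by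
      have h := totD₃_smul (0 : ℝ) (0 : TotCochain₃ I J G M)
      simpa using h⟩
  add_mem' := fun {a b} ha hb => ⟨ha.1.add hb.1, by
    rw [totD₃_add ha.1 hb.1, ha.2, hb.2, add_zero]⟩
  smul_mem' := fun r a ha => ⟨ha.1.smul r, by rw [totD₃_smul, ha.2, smul_zero]⟩

variable (I J G M) in
/-- The coboundaries of smooth two-cochains among them. -/
def totCoboundaries₃ [I.Boundaryless] [J.Boundaryless] :
    Submodule ℝ (totCocycles₃ I J G M) where
  carrier := {a | ∃ b : TotCochain₂ I J G M, TotCochain₂.IsSmooth b ∧ totD₂ b = a.1}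
  zero_mem' := ⟨0, ⟨DForm.isSmooth_zero, DForm.isSmooth_zero, DForm.isSmooth_zero⟩, by
    have h := totD₂_smul (0 : ℝ) (0 : TotCochain₂ I J G M)
    simpa using h⟩
  add_mem' := by
    rintro a a' ⟨b, hb, h⟩ ⟨b', hb', h'⟩
    refine ⟨b + b', hb.add hb', ?_⟩
    rw [totD₂_add hb hb', h, h']
    rfl
  smul_mem' := by
    rintro r a ⟨b, hb, h⟩
    refine ⟨r • b, hb.smul r, ?_⟩
    rw [totD₂_smul, h]
    rfl

variable (I J G M) in
/-- The degree three equivariant cohomology of `M`. -/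
abbrev EquivariantH₃ [I.Boundaryless] [J.Boundaryless] : Type _ :=
  totCocycles₃ I J G M ⧸ totCoboundaries₃ I J G M

end Action

end

noncomputable section

set_option linter.unusedSectionVars false

/-! Two facts about a multiplicative form θ on H ⋉ M carry everything.

Rigidity (`IsMultiplicative.eq_zero`): if θ vanishes on all slices {g} × M, it is determined by its
values at the units on ((v, 0), (0, X₁), …, (0, Xₖ)). Factor (g, x) = (g, x)·(1, x) and split a
tangent vector (V, X) so that its whole 𝔥-part λV sits in the second factor; the first factor is
then tangent to a slice and contributes nothing. At the units, multiplicativity again lets one trade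
the 𝔥-components of the other arguments for their infinitesimal actions, once one argument is (v,
0).

Slice derivative (`IsAssociatedForm.mfderiv_slice_unit`): since dθ = s^*φ - t^*φ, the derivative at
g = 1, in direction v, of the slice restriction c_g = θ|_{g}×M is d(ρ^*(v)) - i_{ρ(v)}φ.
Multiplicativity makes c a cocycle, c_{gh} = h^*c_g + c_h, so a vanishing derivative at 1 spreads to
all of H; by connectedness c is constant, and c_1 = 2c_1 makes it zero.

Vanishing on slices is the hub of the equivalences. The slice derivative gives (i) → (ii), and the
unit reduction behind rigidity turns (ii) into the explicit formula, which conversely vanishes for V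
= V' = 0. The compact formula differs from the explicit one only by skewness of ⟨ρ^*, ρ⟩. For (ii) →
(i), invariance of ρ^* comes from multiplicativity at (1, gx)·(g, x), invariance of φ from
restricting dθ = s^*φ - t^*φ to slices, d(ρ^*(v)) = i_{ρ(v)}φ from the slice derivative, and
i_{ρ(v)}ρ^*(v) = 0 from skewness.

For existence, the compact formula is taken as definition (`mcTwoForm`). It is multiplicative
because λ_{gh} = Ad_{h⁻¹}λ_g + λ_h and ρ^* is invariant; dω = s^*φ - t^*φ holds by rigidity,
comparing at units. Uniqueness is (i) → (ii) → explicit formula. If ρ^* + φ = d_H(f + β), rigidity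
gives ω = δβ - d(f(λ)), so ω + φ is the total coboundary of (β, f(λ), 0). -/

theorem minSmoothness_two_le_infty : minSmoothness ℝ 2 ≤ ∞ := by
  rw [minSmoothness_of_isRCLikeNormedField]
  exact WithTop.coe_le_coe.2 le_top

/-! ### Smoothness of maps into spaces of alternating forms -/

section AltSmooth

open Filter Topology

variable {E : Type*} [NormedAddCommGroup E] [NormedSpace ℝ E] [FiniteDimensional ℝ E]
  {F : Type*} [NormedAddCommGroup F] [NormedSpace ℝ F] [FiniteDimensional ℝ F] {k : ℕ}

/-- A map into alternating forms on a finite-dimensional space is smooth if its evaluations are. -/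
theorem contDiffAt_alternating_of_apply {X : Type*} [NormedAddCommGroup X] [NormedSpace ℝ X]
    {n : WithTop ℕ∞} {f : X → E [⋀^Fin k]→L[ℝ] ℝ} {x : X}
    (h : ∀ v, ContDiffAt ℝ n (fun y => f y v) x) : ContDiffAt ℝ n f x := by
  classical
  let b := Module.finBasis ℝ E
  let ev : (E [⋀^Fin k]→L[ℝ] ℝ) →ₗ[ℝ] ((Fin k → Fin (Module.finrank ℝ E)) → ℝ) :=
    { toFun := fun A s => A (fun i => b (s i))
      map_add' := fun A B => rfl
      map_smul' := fun c A => rfl }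
  have hinj : LinearMap.ker ev = ⊥ := by
    rw [LinearMap.ker_eq_bot]
    intro A B hAB
    apply ContinuousAlternatingMap.toAlternatingMap_injective
    apply Module.Basis.ext_alternating b
    intro s _
    exact congrFun hAB s
  -- A form is determined by its values on basis tuples; a linear left inverse of `ev` recovers `f`
  -- from finitely many evaluations, and it is continuous because its source is finite-dimensional.
  obtain ⟨g, hg⟩ := LinearMap.exists_leftInverse_of_injective ev hinj
  have hfg : f = fun y => LinearMap.toContinuousLinearMap g (fun s => f y (fun i => b (s i))) := by
    funext y
    exact (LinearMap.congr_fun hg (f y)).symm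
  rw [hfg]
  exact (LinearMap.toContinuousLinearMap g).contDiff.contDiffAt.comp x
    (contDiffAt_pi.2 fun s => h _)

theorem ContDiffAt.alternating_apply {X : Type*} [NormedAddCommGroup X] [NormedSpace ℝ X]
    {n : WithTop ℕ∞} {f : X → E [⋀^Fin k]→L[ℝ] ℝ} {x : X}
    (h : ContDiffAt ℝ n f x) (v : Fin k → E) : ContDiffAt ℝ n (fun y => f y v) x :=
  (ContinuousAlternatingMap.apply ℝ E ℝ v).contDiff.contDiffAt.comp x h

/-- Expanding each `g y (v i)` in a basis of `F` turns the composite into a finite sum of products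
of coordinates of `g y` with evaluations of `f y` on constant vectors. -/
theorem ContDiffAt.alternating_comp {X : Type*} [NormedAddCommGroup X] [NormedSpace ℝ X]
    {n : WithTop ℕ∞} {f : X → F [⋀^Fin k]→L[ℝ] ℝ} {g : X → E →L[ℝ] F} {x : X}
    (hf : ContDiffAt ℝ n f x) (hg : ContDiffAt ℝ n g x) :
    ContDiffAt ℝ n (fun y => (f y).compContinuousLinearMap (g y)) x := by
  refine contDiffAt_alternating_of_apply fun v => ?_
  let b := Module.finBasis ℝ F
  have hexp : ∀ y, (f y).compContinuousLinearMap (g y) v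
      = ∑ s : Fin k → Fin (Module.finrank ℝ F),
          (∏ i, LinearMap.toContinuousLinearMap (b.coord (s i)) (g y (v i))) *
            f y (fun i => b (s i)) := by
    intro y
    have h₁ : (fun i => g y (v i)) = fun i => ∑ j, b.coord j (g y (v i)) • b j :=
      funext fun i => (b.sum_repr (g y (v i))).symm
    change f y (fun i => g y (v i)) = _
    rw [h₁]
    refine ((f y).toMultilinearMap.map_sum (fun i j => b.coord j (g y (v i)) • b j)).trans
      (Finset.sum_congr rfl fun s _ => ?_)
    exact (f y).toMultilinearMap.map_smul_univ _ _
  simp only [hexp]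
  refine ContDiffAt.sum fun s _ => ContDiffAt.mul (contDiffAt_prod fun i _ => ?_)
    (hf.alternating_apply _)
  exact (ContinuousLinearMap.contDiff _).contDiffAt.comp x (hg.clm_apply contDiffAt_const)

end AltSmooth

/-! ### Forms in charts; pull-back preserves smoothness and commutes with d -/

section FormCalculus

open Filter Topology

variable {E : Type*} [NormedAddCommGroup E] [NormedSpace ℝ E]
  {K : Type*} [TopologicalSpace K]
  {F : Type*} [NormedAddCommGroup F] [NormedSpace ℝ F]
  {L : Type*} [TopologicalSpace L]
  {I : ModelWithCorners ℝ E K} {M : Type*} [TopologicalSpace M] [ChartedSpace K M]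
  {J : ModelWithCorners ℝ F L} {N : Type*} [TopologicalSpace N] [ChartedSpace L N]
  {k : ℕ}

/-- Every tangent space is definitionally the model space `E`, so the same tuple `v` can be fed to a
form at two equal points without transport. -/
theorem DForm.apply_congr_point (θ : DForm I M k) {x y : M} (h : x = y) (v : Fin k → E) :
    θ x v = θ y v := by
  subst h; rfl

theorem DForm.congr_vec (θ : DForm I M k) (x : M) {v w : Fin k → E} (h : ∀ i, v i = w i) :
    θ x v = θ x w := by
  rw [funext h]

section

variable [I.Boundaryless]

theorem contMDiffAt_extChartAt_symm' {n : WithTop ℕ∞} [IsManifold I n M] {x₀ : M} {y : E}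
    (hy : y ∈ (extChartAt I x₀).target) :
    ContMDiffAt 𝓘(ℝ, E) I n (extChartAt I x₀).symm y :=
  (contMDiffOn_extChartAt_symm x₀ y hy).contMDiffAt ((isOpen_extChartAt_target x₀).mem_nhds hy)

theorem mdifferentiableAt_extChartAt_symm [IsManifold I 1 M] {x₀ : M} {y : E}
    (hy : y ∈ (extChartAt I x₀).target) :
    MDifferentiableAt 𝓘(ℝ, E) I (extChartAt I x₀).symm y :=
  (contMDiffAt_extChartAt_symm' (n := 1) hy).mdifferentiableAt one_ne_zero

theorem mfderiv_extChartAt_symm_self [IsManifold I 1 M] (x : M) (v : E) :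
    (mfderiv 𝓘(ℝ, E) I (extChartAt I x).symm (extChartAt I x x) v : E) = v := by
  have h := mfderivWithin_range_extChartAt_symm (I := I) (x := x)
  rw [I.range_eq_univ, mfderivWithin_univ] at h
  rw [h]
  rfl

/-- The tangent space at `x` is coordinatised by the preferred chart at `x`, so the derivative of
that chart at its own centre is the identity. -/
theorem DForm.d_apply [IsManifold I 1 M] (θ : DForm I M k) (x : M) (v : Fin (k + 1) → E) :
    θ.d x v = extDeriv (θ.inChart x) (extChartAt I x x) v := by
  change extDeriv (θ.inChart x) (extChartAt I x x)
    (fun i => (mfderiv I 𝓘(ℝ, E) (extChartAt I x) x (v i) : E)) = _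
  rw [mfderiv_extChartAt_self]
  rfl

variable [J.Boundaryless]

/-- Reduces manifold pull-back to pull-back between vector spaces. The charts are arbitrary, because
smoothness is tested at points other than the chart centre, and the identity holds on a
neighbourhood, so that it may be differentiated. -/
theorem DForm.eventually_inChart_pullback [IsManifold I 1 M] [IsManifold J 1 N]
    (θ : DForm J N k) {f : M → N} {x₀ : M} {q₀ : N} {y₀ : E}
    (hy₀ : y₀ ∈ (extChartAt I x₀).target)
    (hf : ContMDiffAt I J 1 f ((extChartAt I x₀).symm y₀))
    (hq : f ((extChartAt I x₀).symm y₀) ∈ (extChartAt J q₀).source) :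
    ∀ᶠ y in 𝓝 y₀, (DForm.pullback I J f θ).inChart x₀ y =
      (θ.inChart q₀ ((extChartAt J q₀ ∘ f ∘ (extChartAt I x₀).symm) y)).compContinuousLinearMap
        (fderiv ℝ (extChartAt J q₀ ∘ f ∘ (extChartAt I x₀).symm) y) := by
  have hs : ContinuousAt (extChartAt I x₀).symm y₀ :=
    (mdifferentiableAt_extChartAt_symm hy₀).continuousAt
  have e₁ : ∀ᶠ y in 𝓝 y₀, y ∈ (extChartAt I x₀).target :=
    (isOpen_extChartAt_target x₀).mem_nhds hy₀
  have e₂ : ∀ᶠ y in 𝓝 y₀, ContMDiffAt I J 1 f ((extChartAt I x₀).symm y) :=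
    hs.eventually ((contMDiffAt_iff_contMDiffAt_nhds (by simp)).1 hf)
  have e₃ : ∀ᶠ y in 𝓝 y₀, (f ∘ (extChartAt I x₀).symm) y ∈ (extChartAt J q₀).source :=
    (hf.continuousAt.comp hs).eventually_mem ((isOpen_extChartAt_source q₀).mem_nhds hq)
  filter_upwards [e₁, e₂, e₃, e₃.eventually_nhds] with y h₁ h₂ h₃ h₄
  have hfd := h₂.mdifferentiableAt one_ne_zero
  have hsd := mdifferentiableAt_extChartAt_symm h₁
  have hF : MDifferentiableAt 𝓘(ℝ, E) 𝓘(ℝ, F) (extChartAt J q₀ ∘ f ∘ (extChartAt I x₀).symm) y :=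
    (mdifferentiableAt_extChartAt (by rwa [extChartAt_source] at h₃)).comp y (hfd.comp y hsd)
  have hc : (extChartAt J q₀).symm ∘ (extChartAt J q₀ ∘ f ∘ (extChartAt I x₀).symm) =ᶠ[𝓝 y]
      f ∘ (extChartAt I x₀).symm := by
    filter_upwards [h₄] with z hz
    exact (extChartAt J q₀).left_inv hz
  have hd : ∀ v : E, (mfderiv 𝓘(ℝ, F) J (extChartAt J q₀).symm
      ((extChartAt J q₀ ∘ f ∘ (extChartAt I x₀).symm) y)
      (fderiv ℝ (extChartAt J q₀ ∘ f ∘ (extChartAt I x₀).symm) y v) : F)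
      = mfderiv I J f ((extChartAt I x₀).symm y)
        (mfderiv 𝓘(ℝ, E) I (extChartAt I x₀).symm y v) := by
    intro v
    have a₁ := mfderiv_comp_apply y
      (mdifferentiableAt_extChartAt_symm ((extChartAt J q₀).map_source h₃)) hF v
    have a₂ := mfderiv_comp_apply y hfd hsd v
    have a₃ : (mfderiv 𝓘(ℝ, E) J ((extChartAt J q₀).symm ∘
        (extChartAt J q₀ ∘ f ∘ (extChartAt I x₀).symm)) y v : F)
        = mfderiv 𝓘(ℝ, E) J (f ∘ (extChartAt I x₀).symm) y v := by
      rw [hc.mfderiv_eq]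
      rfl
    rw [← mfderiv_eq_fderiv]
    exact a₁.symm.trans (a₃.trans a₂)
  ext v
  change θ (f ((extChartAt I x₀).symm y)) (fun i => mfderiv I J f ((extChartAt I x₀).symm y)
        (mfderiv 𝓘(ℝ, E) I (extChartAt I x₀).symm y (v i)))
    = θ ((extChartAt J q₀).symm (extChartAt J q₀ (f ((extChartAt I x₀).symm y))))
      (fun i => mfderiv 𝓘(ℝ, F) J (extChartAt J q₀).symm _ (fderiv ℝ _ y (v i)))
  have hpt := (extChartAt J q₀).left_inv h₃
  refine Eq.trans ?_ (DForm.apply_congr_point θ hpt.symm _)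
  congr 1
  funext i
  exact (hd (v i)).symm

variable [IsManifold I ∞ M] [IsManifold J ∞ N]

theorem contDiffAt_writtenInCharts {f : M → N} {x₀ : M} {q₀ : N} {y₀ : E}
    (hy₀ : y₀ ∈ (extChartAt I x₀).target)
    (hf : ContMDiffAt I J ∞ f ((extChartAt I x₀).symm y₀))
    (hq : f ((extChartAt I x₀).symm y₀) ∈ (extChartAt J q₀).source) :
    ContDiffAt ℝ ∞ (extChartAt J q₀ ∘ f ∘ (extChartAt I x₀).symm) y₀ := by
  rw [← contMDiffAt_iff_contDiffAt]
  exact (contMDiffAt_extChartAt' (by rwa [extChartAt_source] at hq)).comp y₀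
    (hf.comp y₀ (contMDiffAt_extChartAt_symm' hy₀))

omit [IsManifold I ∞ M] in
theorem DForm.IsSmooth.contDiffAt {θ : DForm I M k} (hθ : θ.IsSmooth) {x₀ : M} {y : E}
    (hy : y ∈ (extChartAt I x₀).target) : ContDiffAt ℝ ∞ (θ.inChart x₀) y :=
  (hθ x₀).contDiffAt ((isOpen_extChartAt_target x₀).mem_nhds hy)

omit [I.Boundaryless] [IsManifold I ∞ M] in
theorem DForm.isSmooth_of_contDiffAt {θ : DForm I M k}
    (h : ∀ x₀, ∀ y ∈ (extChartAt I x₀).target, ContDiffAt ℝ ∞ (θ.inChart x₀) y) : θ.IsSmooth :=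
  fun x₀ y hy => (h x₀ y hy).contDiffWithinAt

theorem DForm.IsSmooth.pullback [FiniteDimensional ℝ E] [FiniteDimensional ℝ F]
    {θ : DForm J N k} (hθ : θ.IsSmooth) {f : M → N} (hf : ContMDiff I J ∞ f) :
    DForm.IsSmooth (DForm.pullback I J f θ) := by
  refine DForm.isSmooth_of_contDiffAt fun x₀ y hy => ?_
  have hq := mem_extChartAt_source (I := J) (f ((extChartAt I x₀).symm y))
  have hF := contDiffAt_writtenInCharts hy hf.contMDiffAt hq
  refine ContDiffAt.congr_of_eventuallyEq ?_ (DForm.eventually_inChart_pullback θ hy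
    (hf.contMDiffAt.of_le (by simp)) hq)
  refine ContDiffAt.alternating_comp ?_ (hF.fderiv_right (m := ∞) (by simp))
  exact ContDiffAt.comp y (hθ.contDiffAt (mem_extChartAt_target _)) hF

/-- The exterior derivative commutes with pull-back. -/
theorem DForm.d_pullback_at {θ : DForm J N k} (hθ : θ.IsSmooth) {f : M → N} {x : M}
    (hf : ContMDiffAt I J ∞ f x) :
    (DForm.pullback I J f θ).d x = DForm.pullback I J f θ.d x := by
  have hx := mem_extChartAt_target (I := I) x
  have hsx : (extChartAt I x).symm (extChartAt I x x) = x := extChartAt_to_inv x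
  have hf' : ContMDiffAt I J ∞ f ((extChartAt I x).symm (extChartAt I x x)) := by rwa [hsx]
  have hq : f ((extChartAt I x).symm (extChartAt I x x)) ∈ (extChartAt J (f x)).source := by
    rw [hsx]; exact mem_extChartAt_source _
  have hF := contDiffAt_writtenInCharts hx hf' hq
  have hFx : (extChartAt J (f x) ∘ f ∘ (extChartAt I x).symm) (extChartAt I x x)
      = extChartAt J (f x) (f x) := by simp
  have hev := DForm.eventually_inChart_pullback θ hx (hf'.of_le (by simp)) hq
  ext v
  have h₁ := DForm.d_apply (DForm.pullback I J f θ) x v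
  rw [Filter.EventuallyEq.extDeriv_eq hev, extDeriv_pullback (r := ∞) ?_ hF minSmoothness_two_le_infty]
    at h₁
  · refine h₁.trans ?_
    have h₂ := DForm.d_apply θ (f x) (fun i => (mfderiv I J f x (v i) : F))
    refine Eq.trans ?_ h₂.symm
    rw [hFx]
    -- By definition, `mfderiv` at `x` is the derivative of the expression of `f` in the preferred
    -- charts at `x` and `f x`, which are the charts in use.
    have hm : (mfderiv I J f x : E →L[ℝ] F)
        = fderiv ℝ (extChartAt J (f x) ∘ f ∘ (extChartAt I x).symm) (extChartAt I x x) := by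
      rw [(hf.mdifferentiableAt (by simp)).mfderiv, I.range_eq_univ, fderivWithin_univ]
      rfl
    change _ = extDeriv (θ.inChart (f x)) (extChartAt J (f x) (f x))
      (fun i => (mfderiv I J f x : E →L[ℝ] F) (v i))
    rw [hm]
    rfl
  · rw [hFx]
    exact hθ.differentiableAt (f x)

theorem DForm.d_pullback {θ : DForm J N k} (hθ : θ.IsSmooth) {f : M → N}
    (hf : ContMDiff I J ∞ f) :
    (DForm.pullback I J f θ).d = DForm.pullback I J f θ.d :=
  funext fun _ => DForm.d_pullback_at hθ hf.contMDiffAt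

end

end FormCalculus

/-! ### Differentials of translations, of the action and of the groupoid structure maps -/

section GroupCalculus

/-- The chain rule with the intermediate point and the factorisation given only propositionally.
Each identity below comes from factoring one map in two ways. -/
theorem mfderiv_apply_of_comp_eq
    {E : Type*} [NormedAddCommGroup E] [NormedSpace ℝ E] {K : Type*} [TopologicalSpace K]
    {I : ModelWithCorners ℝ E K}
    {F : Type*} [NormedAddCommGroup F] [NormedSpace ℝ F] {L : Type*} [TopologicalSpace L]
    {J : ModelWithCorners ℝ F L}
    {E' : Type*} [NormedAddCommGroup E'] [NormedSpace ℝ E'] {K' : Type*} [TopologicalSpace K']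
    {I' : ModelWithCorners ℝ E' K'}
    {M : Type*} [TopologicalSpace M] [ChartedSpace K M]
    {N : Type*} [TopologicalSpace N] [ChartedSpace L N]
    {P : Type*} [TopologicalSpace P] [ChartedSpace K' P]
    {f : M → N} {g : N → P} {h : M → P} {x : M} {y : N} (hy : f x = y)
    (hg : MDifferentiableAt J I' g y) (hf : MDifferentiableAt I J f x)
    (hh : ∀ z, h z = g (f z)) (v : E) :
    (mfderiv I I' h x v : E') = mfderiv J I' g y (mfderiv I J f x v : F) := by
  obtain rfl : h = g ∘ f := funext hh
  subst hy
  exact mfderiv_comp_apply x hg hf v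

variable {E : Type*} [NormedAddCommGroup E] [NormedSpace ℝ E]
  {K : Type*} [TopologicalSpace K] {I : ModelWithCorners ℝ E K}
  {F : Type*} [NormedAddCommGroup F] [NormedSpace ℝ F]
  {L : Type*} [TopologicalSpace L] {J : ModelWithCorners ℝ F L}
  {G : Type*} [TopologicalSpace G] [ChartedSpace K G] [Group G] [LieGroup I ∞ G]
  {M : Type*} [TopologicalSpace M] [ChartedSpace L M] [MulAction G M]

section

variable (I)

theorem mdifferentiableAt_leftMul (g h : G) :
    MDifferentiableAt I I (fun k : G => g * k) h :=
  (contMDiff_mul_left (I := I) (n := ∞) (a := g)).mdifferentiableAt (by simp)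

theorem mdifferentiableAt_rightMul (g h : G) :
    MDifferentiableAt I I (fun k : G => k * g) h :=
  (contMDiff_mul_right (I := I) (n := ∞) (a := g)).mdifferentiableAt (by simp)

theorem mdifferentiableAt_conj (g h : G) :
    MDifferentiableAt I I (fun k : G => g * k * g⁻¹) h :=
  (mdifferentiableAt_rightMul I g⁻¹ (g * h)).comp h (mdifferentiableAt_leftMul I g h)

end

theorem maurerCartan_add (g : G) (V W : TangentSpace I g) :
    maurerCartan g (V + W) = maurerCartan g V + maurerCartan g W :=
  (mfderiv I I (fun h : G => g⁻¹ * h) g).map_add V W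

theorem maurerCartan_smul (g : G) (c : ℝ) (V : TangentSpace I g) :
    maurerCartan g (c • V) = c • maurerCartan g V :=
  (mfderiv I I (fun h : G => g⁻¹ * h) g).map_smul c V

theorem maurerCartan_zero (g : G) : maurerCartan (I := I) g 0 = 0 :=
  (mfderiv I I (fun h : G => g⁻¹ * h) g).map_zero

/-- Both sides differentiate k ↦ (gh)⁻¹kh = h⁻¹(g⁻¹k)h at k = g. -/
theorem maurerCartan_mul_right (g h : G) (V : E) :
    maurerCartan (I := I) (g * h) (mfderiv I I (fun k : G => k * h) g V : E)
      = adjointAction h⁻¹ (maurerCartan g V) := by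
  have h₁ := mfderiv_apply_of_comp_eq (I := I) (J := I) (I' := I)
    (f := fun k : G => k * h) (g := fun k => (g * h)⁻¹ * k)
    (h := fun k => (g * h)⁻¹ * (k * h)) (x := g) rfl (mdifferentiableAt_leftMul I _ _)
    (mdifferentiableAt_rightMul I _ _) (fun _ => rfl) V
  have h₂ := mfderiv_apply_of_comp_eq (I := I) (J := I) (I' := I)
    (f := fun k : G => g⁻¹ * k) (g := fun k => h⁻¹ * k * h⁻¹⁻¹)
    (h := fun k => (g * h)⁻¹ * (k * h)) (x := g) (y := 1) (by simp) (mdifferentiableAt_conj I _ _)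
    (mdifferentiableAt_leftMul I _ _) (fun _ => by group) V
  exact h₁.symm.trans h₂

theorem maurerCartan_mul_left (g h : G) (W : E) :
    maurerCartan (I := I) (g * h) (mfderiv I I (fun k : G => g * k) h W : E)
      = maurerCartan h W :=
  (mfderiv_apply_of_comp_eq (I := I) (J := I) (I' := I)
    (f := fun k : G => g * k) (g := fun k => (g * h)⁻¹ * k)
    (h := fun k => h⁻¹ * k) (x := h) rfl (mdifferentiableAt_leftMul I _ _)
    (mdifferentiableAt_leftMul I _ _) (fun _ => by group) W).symm

theorem maurerCartan_one (v : E) : maurerCartan (I := I) (1 : G) v = v := by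
  have h : (fun h : G => (1 : G)⁻¹ * h) = id := by funext h; simp
  change (mfderiv I I (fun h : G => (1 : G)⁻¹ * h) 1 v : E) = v
  rw [h, mfderiv_id]
  rfl

theorem mfderiv_mul_left_maurerCartan (g : G) (V : E) :
    (mfderiv I I (fun k : G => g * k) 1 (maurerCartan (I := I) g V) : E) = V := by
  have h := mfderiv_apply_of_comp_eq (I := I) (J := I) (I' := I)
    (f := fun k : G => g⁻¹ * k) (g := fun k => g * k) (h := id) (x := g) (y := 1) (by simp)
    (mdifferentiableAt_leftMul I _ _) (mdifferentiableAt_leftMul I _ _) (fun _ => by simp) V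
  refine h.symm.trans ?_
  rw [mfderiv_id]
  rfl

theorem adjointAction_inv_apply (g : G) (v : GroupLieAlgebra I G) :
    adjointAction g⁻¹ (adjointAction g v) = v := by
  have h := mfderiv_apply_of_comp_eq (I := I) (J := I) (I' := I)
    (f := fun k : G => g * k * g⁻¹) (g := fun k => g⁻¹ * k * g⁻¹⁻¹) (h := id) (x := 1) (y := 1)
    (by simp) (mdifferentiableAt_conj I _ _) (mdifferentiableAt_conj I _ _)
    (fun _ => by simp [mul_assoc]) v
  refine h.symm.trans ?_
  rw [mfderiv_id]
  rfl

theorem infAction_add (v w : GroupLieAlgebra I G) (x : M) :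
    infAction I J (v + w) x = infAction I J v x + infAction I J w x :=
  (mfderiv I J (fun g : G => g • x) 1).map_add v w

theorem infAction_smul_left (c : ℝ) (v : GroupLieAlgebra I G) (x : M) :
    infAction I J (c • v) x = c • infAction I J v x :=
  (mfderiv I J (fun g : G => g • x) 1).map_smul c v

theorem infAction_zero (x : M) : infAction I J (0 : GroupLieAlgebra I G) x = 0 :=
  (mfderiv I J (fun g : G => g • x) 1).map_zero

variable [ContMDiffSMul I J ∞ G M]

section

variable (I J)

theorem contMDiff_const_smul_action (I : ModelWithCorners ℝ E K) (J : ModelWithCorners ℝ F L)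
    [ContMDiffSMul I J ∞ G M] (g : G) : ContMDiff J J ∞ (fun x : M => g • x) :=
  ContMDiffSMul.contMDiff_const_smul (I := I) g

theorem contMDiff_orbit (x : M) : ContMDiff I J ∞ (fun g : G => g • x) :=
  contMDiff_id.smul (I := I) (I' := J) contMDiff_const

theorem mdifferentiableAt_const_smul_action (I : ModelWithCorners ℝ E K)
    (J : ModelWithCorners ℝ F L) [ContMDiffSMul I J ∞ G M] (g : G) (x : M) :
    MDifferentiableAt J J (fun x : M => g • x) x :=
  (contMDiff_const_smul_action I J g).mdifferentiableAt (by simp)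

theorem mdifferentiableAt_orbit (g : G) (x : M) :
    MDifferentiableAt I J (fun g : G => g • x) g :=
  (contMDiff_orbit I J x).mdifferentiableAt (by simp)

end

/-- Differentiate k x = h((h⁻¹k)x) at k = h. -/
theorem mfderiv_orbit (h : G) (x : M) (W : E) :
    (mfderiv I J (fun k : G => k • x) h W : F)
      = mfderiv J J (fun y : M => h • y) x (infAction I J (maurerCartan (I := I) h W) x) := by
  have h₁ := mfderiv_apply_of_comp_eq (I := I) (J := I) (I' := J)
    (f := fun k : G => h⁻¹ * k) (g := fun k => k • x) (h := fun k => (h⁻¹ * k) • x) (x := h)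
    (y := 1) (by simp) (mdifferentiableAt_orbit I J _ _) (mdifferentiableAt_leftMul I _ _)
    (fun _ => rfl) W
  have h₂ := mfderiv_apply_of_comp_eq (I := I) (J := J) (I' := J)
    (f := fun k : G => (h⁻¹ * k) • x) (g := fun y => h • y) (h := fun k => k • x) (x := h)
    (y := x) (by simp) (mdifferentiableAt_const_smul_action I J _ _)
    ((mdifferentiableAt_orbit I J _ _).comp h (mdifferentiableAt_leftMul I _ _))
    (fun _ => by simp [← mul_smul]) W
  rw [h₂, h₁]
  rfl

/-- Equivariance of ρ: differentiate k(hx) = h((h⁻¹kh)x) at k = 1. -/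
theorem infAction_smul (h : G) (v : GroupLieAlgebra I G) (x : M) :
    (infAction I J v (h • x) : F)
      = mfderiv J J (fun y : M => h • y) x (infAction I J (adjointAction h⁻¹ v) x) := by
  have h₁ := mfderiv_apply_of_comp_eq (I := I) (J := I) (I' := J)
    (f := fun k : G => h⁻¹ * k * h⁻¹⁻¹) (g := fun k => k • x)
    (h := fun k => (h⁻¹ * k * h⁻¹⁻¹) • x) (x := 1)
    (y := 1) (by simp) (mdifferentiableAt_orbit I J _ _) (mdifferentiableAt_conj I _ _)
    (fun _ => rfl) v
  have h₂ := mfderiv_apply_of_comp_eq (I := I) (J := J) (I' := J)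
    (f := fun k : G => (h⁻¹ * k * h⁻¹⁻¹) • x) (g := fun y => h • y) (h := fun k => k • h • x)
    (x := 1) (y := x) (by simp) (mdifferentiableAt_const_smul_action I J _ _)
    ((mdifferentiableAt_orbit I J _ _).comp 1 (mdifferentiableAt_conj I _ _))
    (fun _ => by simp [← mul_smul, ← mul_assoc]) v
  refine h₂.trans ?_
  rw [h₁]
  rfl

theorem contMDiff_actSource : ContMDiff (I.prod J) J ∞ (actSource (G := G) (M := M)) :=
  contMDiff_snd

theorem contMDiff_actTarget : ContMDiff (I.prod J) J ∞ (actTarget (G := G) (M := M)) :=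
  contMDiff_smul

theorem contMDiff_actPr₂ :
    ContMDiff (I.prod (I.prod J)) (I.prod J) ∞ (actPr₂ (G := G) (M := M)) :=
  contMDiff_snd

theorem contMDiff_actMul :
    ContMDiff (I.prod (I.prod J)) (I.prod J) ∞ (actMul (G := G) (M := M)) :=
  (contMDiff_fst.mul contMDiff_snd.fst).prodMk contMDiff_snd.snd

theorem contMDiff_actPr₁ :
    ContMDiff (I.prod (I.prod J)) (I.prod J) ∞ (actPr₁ (G := G) (M := M)) :=
  contMDiff_fst.prodMk (contMDiff_snd.fst.smul (I := I) (I' := J) contMDiff_snd.snd)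

theorem contMDiff_slice (g : G) : ContMDiff J (I.prod J) ∞ (fun x : M => (g, x)) :=
  contMDiff_const.prodMk contMDiff_id

theorem mfderiv_slice (g : G) (x : M) (X : TangentSpace J x) :
    mfderiv J (I.prod J) (fun x : M => (g, x)) x X = pairVec (I := I) (g := g) 0 X := by
  rw [mfderiv_prod_right]
  rfl

theorem mfderiv_actSource (g : G) (x : M) (V : TangentSpace I g) (X : TangentSpace J x) :
    mfderiv (I.prod J) J (actSource (G := G) (M := M)) (g, x) (pairVec V X) = X := by
  change mfderiv (I.prod J) J Prod.snd (g, x) (pairVec V X) = X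
  rw [mfderiv_snd]
  rfl

/-- Pulling the orbit direction back through the translation by `g` expresses dt through λ and
vectors at `x` only, which is the form all later computations use. -/
theorem mfderiv_actTarget (g : G) (x : M) (V : TangentSpace I g) (X : TangentSpace J x) :
    mfderiv (I.prod J) J (actTarget (G := G) (M := M)) (g, x) (pairVec V X)
      = mfderiv J J (fun y : M => g • y) x (X + infAction I J (maurerCartan g V) x) := by
  have h := mfderiv_prod_eq_add_apply (p := (g, x)) (v := ((V, X) : E × F))
    ((contMDiff_actTarget (I := I) (J := J) (G := G) (M := M)).mdifferentiableAt (by simp))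
  refine h.trans ?_
  have h₁ := mfderiv_orbit (I := I) (J := J) g x V
  refine Eq.trans ?_ ((mfderiv J J (fun y : M => g • y) x).map_add X _).symm
  rw [add_comm]
  exact congrArg _ h₁

theorem mfderiv_actPr₂ (g h : G) (x : M) (V : TangentSpace I g) (W : TangentSpace I h)
    (X : TangentSpace J x) :
    mfderiv (I.prod (I.prod J)) (I.prod J) (actPr₂ (G := G) (M := M)) (g, h, x)
      (pairVec V (pairVec W X)) = pairVec W X := by
  change mfderiv (I.prod (I.prod J)) (I.prod J) Prod.snd (g, h, x)
      (pairVec V (pairVec W X)) = pairVec W X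
  rw [mfderiv_snd]
  rfl

theorem mfderiv_prodMk_apply {P : Type*} [TopologicalSpace P] {E' : Type*}
    [NormedAddCommGroup E'] [NormedSpace ℝ E'] {K' : Type*} [TopologicalSpace K']
    {I' : ModelWithCorners ℝ E' K'} [ChartedSpace K' P] {f : P → G} {f' : P → M} {p : P}
    (hf : MDifferentiableAt I' I f p) (hf' : MDifferentiableAt I' J f' p) (v : E') :
    (mfderiv I' (I.prod J) (fun q => (f q, f' q)) p v : E × F)
      = (mfderiv I' I f p v, mfderiv I' J f' p v) := by
  rw [mfderiv_prodMk hf hf']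
  rfl

theorem mfderiv_actMul (g h : G) (x : M) (V : TangentSpace I g) (W : TangentSpace I h)
    (X : TangentSpace J x) :
    mfderiv (I.prod (I.prod J)) (I.prod J) (actMul (G := G) (M := M)) (g, h, x)
      (pairVec V (pairVec W X))
      = pairVec (I := I) (g := g * h)
        (mfderiv I I (fun k : G => k * h) g V + mfderiv I I (fun k : G => g * k) h W) X := by
  have hm : ContMDiff (I.prod (I.prod J)) I ∞ (fun p : G × G × M => p.1 * p.2.1) :=
    contMDiff_fst.mul contMDiff_snd.fst
  have hs : ContMDiff (I.prod (I.prod J)) J ∞ (fun p : G × G × M => p.2.2) := contMDiff_snd.snd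
  refine (mfderiv_prodMk_apply (hm.mdifferentiableAt (by simp)) (hs.mdifferentiableAt (by simp))
    _).trans (Prod.ext ?_ ?_)
  · refine (mfderiv_prod_eq_add_apply (hm.mdifferentiableAt (by simp))).trans ?_
    refine congrArg (fun w => mfderiv I I (fun k : G => k * h) g V + w) ?_
    refine (mfderiv_apply_of_comp_eq (I := I.prod J) (J := I) (I' := I)
      (f := Prod.fst) (g := fun k : G => g * k) (x := (h, x)) (y := h) rfl
      (mdifferentiableAt_leftMul I _ _) mdifferentiableAt_fst (fun _ => rfl) (W, X)).trans ?_
    rw [mfderiv_fst]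
    rfl
  · refine (mfderiv_apply_of_comp_eq (I := I.prod (I.prod J)) (J := I.prod J) (I' := J)
      (f := Prod.snd) (g := Prod.snd) (x := (g, h, x)) (y := (h, x)) rfl
      mdifferentiableAt_snd mdifferentiableAt_snd (fun _ => rfl) (V, W, X)).trans ?_
    rw [mfderiv_snd, mfderiv_snd]
    rfl

theorem mfderiv_actPr₁ (g h : G) (x : M) (V : TangentSpace I g) (W : TangentSpace I h)
    (X : TangentSpace J x) :
    mfderiv (I.prod (I.prod J)) (I.prod J) (actPr₁ (G := G) (M := M)) (g, h, x)
      (pairVec V (pairVec W X))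
      = pairVec (I := I) (J := J) (g := g) (x := h • x) V (mfderiv J J (fun y : M => h • y) x
        (X + infAction I J (maurerCartan h W) x)) := by
  have ht : ContMDiff (I.prod (I.prod J)) J ∞ (fun p : G × G × M => p.2.1 • p.2.2) :=
    contMDiff_snd.fst.smul (I := I) (I' := J) contMDiff_snd.snd
  refine (mfderiv_prodMk_apply mdifferentiableAt_fst (ht.mdifferentiableAt (by simp))
    _).trans (Prod.ext ?_ ?_)
  · rw [mfderiv_fst]
    rfl
  · refine (mfderiv_apply_of_comp_eq (I := I.prod (I.prod J)) (J := I.prod J) (I' := J)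
      (f := Prod.snd) (g := actTarget) (x := (g, h, x)) (y := (h, x)) rfl
      ((contMDiff_actTarget (I := I) (J := J)).mdifferentiableAt (by simp))
      mdifferentiableAt_snd (fun _ => rfl) (V, W, X)).trans ?_
    rw [mfderiv_snd]
    exact mfderiv_actTarget h x W X

end GroupCalculus

/-! ### Multiplicative forms and their rigidity -/

section Multiplicative

variable {E : Type*} [NormedAddCommGroup E] [NormedSpace ℝ E]
  {K : Type*} [TopologicalSpace K] {I : ModelWithCorners ℝ E K}
  {F : Type*} [NormedAddCommGroup F] [NormedSpace ℝ F]
  {L : Type*} [TopologicalSpace L] {J : ModelWithCorners ℝ F L}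
  {G : Type*} [TopologicalSpace G] [ChartedSpace K G] [Group G] [LieGroup I ∞ G]
  {M : Type*} [TopologicalSpace M] [ChartedSpace L M] [MulAction G M]
  [ContMDiffSMul I J ∞ G M] {k : ℕ}

/-- The working form of multiplicativity: later arguments are choices of `g`, `h`, `V`, `W` and `X`
here. -/
theorem IsMultiplicative.apply {θ : DForm (I.prod J) (G × M) k} (hθ : IsMultiplicative θ)
    (g h : G) (x : M) (V : Fin k → TangentSpace I g) (W : Fin k → TangentSpace I h)
    (X : Fin k → TangentSpace J x) :
    θ (g * h, x) (fun i => pairVec (I := I) (g := g * h)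
        (mfderiv I I (fun k : G => k * h) g (V i) + mfderiv I I (fun k : G => g * k) h (W i))
        (X i))
      = θ (g, h • x) (fun i => pairVec (I := I) (J := J) (g := g) (x := h • x) (V i)
          (mfderiv J J (fun y : M => h • y) x (X i + infAction I J (maurerCartan h (W i)) x)))
        + θ (h, x) (fun i => pairVec (W i) (X i)) := by
  let A : Fin k → TangentSpace (I.prod (I.prod J)) (g, h, x) :=
    fun i => pairVec (V i) (pairVec (W i) (X i))
  have h₀ : DForm.pullback (I.prod (I.prod J)) (I.prod J) actMul θ (g, h, x) A
      = DForm.pullback (I.prod (I.prod J)) (I.prod J) actPr₁ θ (g, h, x) A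
        + DForm.pullback (I.prod (I.prod J)) (I.prod J) actPr₂ θ (g, h, x) A :=
    congrArg (fun B : TangentSpace (I.prod (I.prod J)) (g, h, x) [⋀^Fin k]→L[ℝ] ℝ => B A)
      (congrFun hθ (g, h, x))
  refine Eq.trans ?_ (h₀.trans (congrArg₂ (· + ·) ?_ ?_))
  · refine DForm.congr_vec θ _ fun i => ?_
    exact (mfderiv_actMul g h x (V i) (W i) (X i)).symm
  · refine DForm.congr_vec θ _ fun i => ?_
    exact mfderiv_actPr₁ g h x (V i) (W i) (X i)
  · refine DForm.congr_vec θ _ fun i => ?_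
    exact mfderiv_actPr₂ g h x (V i) (W i) (X i)

theorem VanishesOnSlices.apply {θ : DForm (I.prod J) (G × M) k} (hθ : VanishesOnSlices θ)
    (g : G) (x : M) (X : Fin k → TangentSpace J x) :
    θ (g, x) (fun i => pairVec (I := I) 0 (X i)) = 0 := by
  have h₀ := congrArg (fun A : TangentSpace J x [⋀^Fin k]→L[ℝ] ℝ => A X) (congrFun (hθ g) x)
  refine Eq.trans ?_ h₀
  exact DForm.congr_vec θ _ fun i => (mfderiv_slice g x (X i)).symm

theorem vanishesOnSlices_iff {θ : DForm (I.prod J) (G × M) k} :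
    VanishesOnSlices θ ↔ ∀ (g : G) (x : M) (X : Fin k → TangentSpace J x),
      θ (g, x) (fun i => pairVec (I := I) 0 (X i)) = 0 := by
  refine ⟨fun h => h.apply, fun h g => ?_⟩
  funext x
  ext X
  exact (DForm.congr_vec θ _ fun i => mfderiv_slice g x (X i)).trans (h g x X)

theorem mfderiv_one_mul_apply (g : G) (V : E) :
    (mfderiv I I (fun k : G => k * 1) g V : E) = V := by
  have h : (fun k : G => k * 1) = id := funext fun k => mul_one k
  rw [h, mfderiv_id]
  rfl

theorem mfderiv_one_mul_left_apply (g : G) (V : E) :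
    (mfderiv I I (fun k : G => 1 * k) g V : E) = V := by
  have h : (fun k : G => 1 * k) = id := funext fun k => one_mul k
  rw [h, mfderiv_id]
  rfl

theorem mfderiv_one_smul_apply (x : M) (X : F) :
    (mfderiv J J (fun y : M => (1 : G) • y) x X : F) = X := by
  have h : (fun y : M => (1 : G) • y) = id := funext fun y => one_smul G y
  rw [h, mfderiv_id]
  rfl

/-- A multiplicative form vanishing on slices is determined by its values at the units. -/
theorem IsMultiplicative.apply_eq_unit {θ : DForm (I.prod J) (G × M) k}
    (hθ : IsMultiplicative θ) (hs : VanishesOnSlices θ) (g : G) (x : M)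
    (V : Fin k → TangentSpace I g) (X : Fin k → TangentSpace J x) :
    θ (g, x) (fun i => pairVec (V i) (X i))
      = θ (1, x) (fun i => pairVec (I := I) (g := 1) (maurerCartan g (V i)) (X i)) := by
  -- Factor `(g, x)` as `(g, 1 • x)` times `(1, x)` with the whole group direction in the second
  -- factor; the vectors at the first factor are then tangent to the slice.
  have h := hθ.apply g 1 x (fun _ => 0) (fun i => maurerCartan g (V i)) X
  rw [hs.apply g ((1 : G) • x), zero_add] at h
  refine Eq.trans ?_ h
  refine (DForm.apply_congr_point θ (by rw [mul_one]) _).trans (DForm.congr_vec θ _ fun i => ?_)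
  refine Prod.ext ?_ rfl
  change (V i : E) = (mfderiv I I (fun k : G => k * 1) g 0 : E)
    + (mfderiv I I (fun k : G => g * k) 1 (maurerCartan g (V i)) : E)
  exact ((congrArg₂ (fun a b : E => a + b) (mfderiv I I (fun k : G => k * 1) g).map_zero
    (mfderiv_mul_left_maurerCartan (I := I) (E := E) g (V i))).trans (zero_add (V i : E))).symm

/-- Multiplicativity at a pair of units. -/
theorem IsMultiplicative.apply_one {θ : DForm (I.prod J) (G × M) k}
    (hθ : IsMultiplicative θ) (x : M)
    (V W : Fin k → TangentSpace I (1 : G)) (X : Fin k → TangentSpace J x) :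
    θ (1, x) (fun i => pairVec (I := I) (g := 1) (V i + W i) (X i))
      = θ (1, x) (fun i => pairVec (I := I) (g := 1) (V i) (X i + infAction I J (W i) x))
        + θ (1, x) (fun i => pairVec (W i) (X i)) := by
  have h := hθ.apply 1 1 x V W X
  refine Eq.trans ?_ (h.trans (congrArg (· + θ (1, x) (fun i => pairVec (W i) (X i))) ?_))
  · refine (DForm.apply_congr_point θ (by rw [mul_one]) _).trans (DForm.congr_vec θ _ fun i => ?_)
    refine Prod.ext ?_ rfl
    exact (congrArg₂ (fun a b : E => a + b) (mfderiv_one_mul_apply (I := I) (1 : G) (V i))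
      (mfderiv_one_mul_left_apply (I := I) (1 : G) (W i))).symm
  · refine (DForm.apply_congr_point θ (by rw [one_smul]) _).trans
      (DForm.congr_vec θ _ fun i => ?_)
    refine Prod.ext rfl ?_
    exact (mfderiv_one_smul_apply (G := G) x _).trans
      (congrArg (fun w => X i + infAction I J w x) (maurerCartan_one (I := I) (E := E) (W i)))

/-- In a multiplicative form at a unit, if one argument is `(v, 0)`, the components along `𝔥` of the
other arguments may be replaced by their infinitesimal actions. -/
theorem IsMultiplicative.apply_unit_update {θ : DForm (I.prod J) (G × M) k}
    (hθ : IsMultiplicative θ) (x : M) (i : Fin k)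
    (V : Fin k → GroupLieAlgebra I G) (X : Fin k → TangentSpace J x) (hX : X i = 0) :
    θ (1, x) (fun j => pairVec (I := I) (g := 1) (V j) (X j))
      = θ (1, x) (fun j => pairVec (I := I) (g := 1) (if j = i then V j else 0)
          (X j + infAction I J (if j = i then 0 else V j) x)) := by
  -- Only slot `i` keeps its 𝔥-component in the first arrow. The second arrow then has the zero
  -- vector in slot `i`, since `X i = 0`, so its term drops out.
  have h := hθ.apply_one x (fun j => if j = i then V j else 0) (fun j => if j = i then 0 else V j) X
  have h₀ : θ (1, x) (fun j => pairVec (I := I) (g := 1) (if j = i then 0 else V j) (X j)) = 0 := by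
    refine (θ (1, x)).map_coord_zero i ?_
    rw [if_pos rfl, hX]
    rfl
  rw [h₀, add_zero] at h
  refine Eq.trans (DForm.congr_vec θ _ fun j => ?_) h
  split_ifs <;> simp <;> rfl

/-- A multiplicative form is zero if it vanishes on slices and on `((v, 0), (0, X₁), …, (0, Xₖ))` at
the units. -/
theorem IsMultiplicative.eq_zero {θ : DForm (I.prod J) (G × M) (k + 1)}
    (hθ : IsMultiplicative θ) (hs : VanishesOnSlices θ)
    (h : ∀ (x : M) (v : GroupLieAlgebra I G) (X : Fin k → TangentSpace J x),
      θ (1, x) (Matrix.vecCons (pairVec (I := I) (g := 1) v 0)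
        (fun i => pairVec (I := I) (g := 1) 0 (X i))) = 0) : θ = 0 := by
  -- A purely group-directed argument in any slot `i` suffices: the other arguments are made tangent
  -- to `M`, and slot `i` is swapped to the front at the cost of a sign.
  have key : ∀ (x : M) (i : Fin (k + 1)) (V : Fin (k + 1) → GroupLieAlgebra I G)
      (X : Fin (k + 1) → TangentSpace J x), X i = 0 →
      θ (1, x) (fun j => pairVec (I := I) (g := 1) (V j) (X j)) = 0 := by
    intro x i V X hX
    rw [hθ.apply_unit_update x i V X hX]
    set Y : Fin (k + 1) → TangentSpace J x :=
      fun j => X j + infAction I J (if j = i then 0 else V j) x with hY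
    have hYi : Y i = 0 := by simp [hY, hX, infAction_zero]
    have hp := (θ (1, x)).toAlternatingMap.map_perm
      (fun j => pairVec (I := I) (g := 1) (if j = i then V j else 0) (Y j)) (Equiv.swap 0 i)
    have hz : (θ (1, x)).toAlternatingMap
        ((fun j => pairVec (I := I) (g := 1) (if j = i then V j else 0) (Y j)) ∘
          Equiv.swap 0 i) = 0 := by
      refine Eq.trans (DForm.congr_vec θ _ fun j => ?_)
        (h x (V i) (fun j => Y (Equiv.swap 0 i j.succ)))
      refine Fin.cases ?_ (fun j => ?_) j
      · change pairVec (I := I) (g := 1) (if Equiv.swap 0 i 0 = i then V (Equiv.swap 0 i 0) else 0)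
          (Y (Equiv.swap 0 i 0)) = pairVec (I := I) (g := 1) (V i) 0
        simp only [Equiv.swap_apply_left, if_true, hYi]
      · change pairVec (I := I) (g := 1) (if Equiv.swap 0 i j.succ = i
          then V (Equiv.swap 0 i j.succ) else 0) (Y (Equiv.swap 0 i j.succ))
          = pairVec (I := I) (g := 1) 0 (Y (Equiv.swap 0 i j.succ))
        have hne : Equiv.swap 0 i j.succ ≠ i := by
          intro hc
          have := (Equiv.swap 0 i).injective (hc.trans (Equiv.swap_apply_left 0 i).symm)
          exact Fin.succ_ne_zero j this
        rw [if_neg hne]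
    rw [hz] at hp
    rcases Int.units_eq_one_or (Equiv.Perm.sign (Equiv.swap 0 i)) with hu | hu
    · rw [hu, one_smul] at hp
      exact hp.symm
    · rw [hu, Units.neg_smul, one_smul, eq_comm, neg_eq_zero] at hp
      exact hp
  funext p
  obtain ⟨g, x⟩ := p
  ext A
  refine (hθ.apply_eq_unit hs g x (fun i => (A i).1) (fun i => (A i).2)).trans ?_
  -- Split each vector into its 𝔥-part and its M-part. In the expansion `s` is the set of slots
  -- carrying the 𝔥-part: the empty set gives a slice term, and any `i ∈ s` puts the term under
  -- `key`.
  have hsum := (θ (1, x)).toMultilinearMap.map_add_univ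
    (fun i => pairVec (I := I) (J := J) (g := 1) (x := x) (maurerCartan g (A i).1) 0)
    (fun i => pairVec (I := I) (J := J) (g := 1) (x := x) 0 (A i).2)
  refine Eq.trans (DForm.congr_vec θ _ fun i => ?_) (hsum.trans (Finset.sum_eq_zero fun s _ => ?_))
  · exact Prod.ext (add_zero _).symm (zero_add _).symm
  · rcases s.eq_empty_or_nonempty with rfl | ⟨i, hi⟩
    · rw [Finset.piecewise_empty]
      exact hs.apply 1 x _
    · refine Eq.trans (DForm.congr_vec θ _ fun j => ?_) (key x i
        (fun j => if j ∈ s then maurerCartan g (A j).1 else 0)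
        (fun j => if j ∈ s then 0 else (A j).2) (if_pos hi))
      by_cases hj : j ∈ s
      · simp only [Finset.piecewise, hj, if_true]
        rfl
      · simp only [Finset.piecewise, hj, if_false]
        rfl

end Multiplicative

/-! ### The exterior derivative on H × M along slices -/

section ProductCharts

open Filter Topology

variable {E : Type*} [NormedAddCommGroup E] [NormedSpace ℝ E]
  {K : Type*} [TopologicalSpace K] {I : ModelWithCorners ℝ E K} [I.Boundaryless]
  {F : Type*} [NormedAddCommGroup F] [NormedSpace ℝ F]
  {L : Type*} [TopologicalSpace L] {J : ModelWithCorners ℝ F L} [J.Boundaryless]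
  {G : Type*} [TopologicalSpace G] [ChartedSpace K G] [IsManifold I 1 G]
  {M : Type*} [TopologicalSpace M] [ChartedSpace L M] [IsManifold J 1 M] {k : ℕ}

theorem mfderiv_extChartAt_symm_prod {g : G} {x : M} {y : E} {z : F}
    (hy : y ∈ (extChartAt I g).target) (hz : z ∈ (extChartAt J x).target) (v : E × F) :
    (mfderiv 𝓘(ℝ, E × F) (I.prod J) (extChartAt (I.prod J) (g, x)).symm (y, z) v : E × F)
      = (mfderiv 𝓘(ℝ, E) I (extChartAt I g).symm y v.1,
          mfderiv 𝓘(ℝ, F) J (extChartAt J x).symm z v.2) := by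
  have h : ((extChartAt (I.prod J) (g, x)).symm : E × F → G × M)
      = Prod.map (extChartAt I g).symm (extChartAt J x).symm := by
    rw [extChartAt_prod]
    rfl
  rw [h, modelWithCornersSelf_prod, ← chartedSpaceSelf_prod,
    mfderiv_prodMap (mdifferentiableAt_extChartAt_symm hy) (mdifferentiableAt_extChartAt_symm hz)]
  rfl

theorem DForm.inChart_prod_apply (θ : DForm (I.prod J) (G × M) k) {g : G} {x : M} {y : E} {z : F}
    (hy : y ∈ (extChartAt I g).target) (hz : z ∈ (extChartAt J x).target) (v : Fin k → E × F) :
    θ.inChart (g, x) (y, z) v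
      = θ ((extChartAt I g).symm y, (extChartAt J x).symm z)
        (fun i => pairVec (mfderiv 𝓘(ℝ, E) I (extChartAt I g).symm y (v i).1)
          (mfderiv 𝓘(ℝ, F) J (extChartAt J x).symm z (v i).2)) := by
  refine Eq.trans ?_ (DForm.apply_congr_point θ (x := (extChartAt (I.prod J) (g, x)).symm (y, z))
    ?_ _)
  · exact DForm.congr_vec θ _ fun i => mfderiv_extChartAt_symm_prod hy hz (v i)
  · rw [extChartAt_prod]
    rfl

theorem DForm.inChart_prod_apply_right (θ : DForm (I.prod J) (G × M) k) {g : G} {x : M} {y : E}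
    (hy : y ∈ (extChartAt I g).target) (X : Fin k → F) :
    θ.inChart (g, x) (y, extChartAt J x x) (fun i => ((0, X i) : E × F))
      = θ ((extChartAt I g).symm y, x) (fun i => pairVec (J := J) 0 (X i)) := by
  rw [DForm.inChart_prod_apply θ hy (mem_extChartAt_target x)]
  refine (DForm.apply_congr_point θ (by rw [extChartAt_to_inv]) _).trans
    (DForm.congr_vec θ _ fun i => Prod.ext ?_ ?_)
  · exact (mfderiv 𝓘(ℝ, E) I (extChartAt I g).symm y).map_zero
  · exact mfderiv_extChartAt_symm_self (I := J) x (X i)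

theorem extChartAt_prod_self (g : G) (x : M) :
    extChartAt (I.prod J) (g, x) (g, x) = (extChartAt I g g, extChartAt J x x) := by
  rw [extChartAt_prod]
  rfl

/-- The values of a smooth form on fixed vectors tangent to the slices are differentiable. -/
theorem DForm.hasMFDerivAt_slice {θ : DForm (I.prod J) (G × M) k} (hθ : θ.IsSmooth) (g : G) (x : M)
    (X : Fin k → F) :
    HasMFDerivAt I 𝓘(ℝ, ℝ) (fun g' : G => θ (g', x) (fun i => pairVec (J := J) 0 (X i))) g
      ((fderiv ℝ (fun p => θ.inChart (g, x) p (fun i => ((0, X i) : E × F)))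
        (extChartAt I g g, extChartAt J x x)).comp (ContinuousLinearMap.inl ℝ E F) :
          E →L[ℝ] ℝ) := by
  have hd : DifferentiableAt ℝ (fun p => θ.inChart (g, x) p (fun i => ((0, X i) : E × F)))
      (extChartAt I g g, extChartAt J x x) := by
    have h := hθ.differentiableAt (g, x)
    rw [extChartAt_prod_self] at h
    exact (ContinuousAlternatingMap.apply ℝ (E × F) ℝ _).differentiableAt.comp _ h
  have hi : HasFDerivAt (fun y : E => ((y, extChartAt J x x) : E × F))
      (ContinuousLinearMap.inl ℝ E F) (extChartAt I g g) := hasFDerivAt_prodMk_left _ _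
  have h₁ := (HasFDerivAt.comp (extChartAt I g g) hd.hasFDerivAt hi).hasMFDerivAt
  have h₂ : HasMFDerivAt I 𝓘(ℝ, E) (extChartAt I g) g (ContinuousLinearMap.id ℝ E) := by
    have h := (mdifferentiableAt_extChartAt (I := I) (mem_chart_source K g)).hasMFDerivAt
    rw [mfderiv_extChartAt_self] at h
    exact h
  have h₃ := h₁.comp g h₂
  -- With the `M`-coordinate frozen at the centre of its chart, the vectors (0, X i) have constant
  -- coordinates, so near `g` the function is the chart expression of `θ` composed with the chart of
  -- `G`.
  refine HasMFDerivAt.congr_of_eventuallyEq h₃ ?_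
  filter_upwards [(isOpen_extChartAt_source (I := I) g).mem_nhds (mem_extChartAt_source g)]
    with g' hg'
  refine Eq.trans ?_
    (DForm.inChart_prod_apply_right θ (x := x) ((extChartAt I g).map_source hg') X).symm
  exact DForm.apply_congr_point θ (by rw [(extChartAt I g).left_inv hg']) _

/-- The exterior derivative of `θ` on `((v, 0), (0, X₀), …, (0, Xₖ))` in terms of the derivative of
the restriction of `θ` to the slices and of the contraction of `θ` with `(v, 0)` along a slice. -/
theorem DForm.d_apply_prod {θ : DForm (I.prod J) (G × M) (k + 1)} (hθ : θ.IsSmooth) (g : G) (x : M)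
    (v : TangentSpace I g) (τ : DForm J M k)
    (h : ∀ (x' : M) (X : Fin k → TangentSpace J x'), θ (g, x')
      (Matrix.vecCons (pairVec v 0) (fun i => pairVec (I := I) 0 (X i))) = τ x' X)
    (hτ : τ.IsSmooth) (X : Fin (k + 1) → TangentSpace J x) :
    θ.d (g, x) (Matrix.vecCons (pairVec v 0) (fun i => pairVec (I := I) 0 (X i))) + τ.d x X
      = mfderiv I 𝓘(ℝ, ℝ) (fun g' : G => θ (g', x) (fun i => pairVec (J := J) 0 (X i))) g v := by
  have hsm := hθ.differentiableAt (g, x)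
  rw [extChartAt_prod_self] at hsm
  have hev : ∀ w : Fin (k + 1) → E × F, DifferentiableAt ℝ (fun p => θ.inChart (g, x) p w)
      (extChartAt I g g, extChartAt J x x) := fun w =>
    (ContinuousAlternatingMap.apply ℝ (E × F) ℝ w).differentiableAt.comp _ hsm
  -- The constant coordinate vector (v, 0) represents `pairVec v 0` along the slice through `g`,
  -- because there the derivative of the inverse chart of `G` is the identity.
  have hτY : ∀ Y : Fin k → F, (fun z : F => θ.inChart (g, x) (extChartAt I g g, z)
      (Matrix.vecCons ((v, 0) : E × F) (fun i => ((0, Y i) : E × F))))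
      =ᶠ[𝓝 (extChartAt J x x)] fun z => τ.inChart x z Y := by
    intro Y
    filter_upwards [(isOpen_extChartAt_target (I := J) x).mem_nhds (mem_extChartAt_target x)]
      with z hz
    rw [DForm.inChart_prod_apply θ (mem_extChartAt_target g) hz]
    refine Eq.trans ?_ (h ((extChartAt J x).symm z)
      (fun i => mfderiv 𝓘(ℝ, F) J (extChartAt J x).symm z (Y i)))
    refine (DForm.apply_congr_point θ (by rw [extChartAt_to_inv]) _).trans
      (DForm.congr_vec θ _ fun i => ?_)
    refine Fin.cases ?_ (fun j => ?_) i
    · exact Prod.ext (mfderiv_extChartAt_symm_self (I := I) g v)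
        (mfderiv 𝓘(ℝ, F) J (extChartAt J x).symm z).map_zero
    · exact Prod.ext (mfderiv 𝓘(ℝ, E) I (extChartAt I g).symm _).map_zero rfl
  have hr : ∀ (Y : Fin k → F) (b : F), fderiv ℝ (fun p => θ.inChart (g, x) p
      (Matrix.vecCons ((v, 0) : E × F) (fun i => ((0, Y i) : E × F))))
      (extChartAt I g g, extChartAt J x x) (0, b)
      = fderiv ℝ (fun z => τ.inChart x z Y) (extChartAt J x x) b := by
    intro Y b
    rw [← (hτY Y).fderiv_eq]
    have hi : HasFDerivAt (fun z : F => ((extChartAt I g g, z) : E × F))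
      (ContinuousLinearMap.inr ℝ E F) (extChartAt J x x) := hasFDerivAt_prodMk_right _ _
    have hc := (HasFDerivAt.comp (extChartAt J x x) (hev
      (Matrix.vecCons ((v, 0) : E × F) (fun i => ((0, Y i) : E × F)))).hasFDerivAt hi).fderiv
    exact (congrArg (fun A : F →L[ℝ] ℝ => A b) hc).symm
  have hτd := hτ.differentiableAt x
  rw [(DForm.hasMFDerivAt_slice hθ g x X).mfderiv]
  have hθd := (DForm.d_apply θ (g, x)
    (Matrix.vecCons ((v, 0) : E × F) (fun i => ((0, X i) : E × F))))
  -- The term of index 0 differentiates the slice values in direction `v`; the term of index j + 1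
  -- differentiates in direction (0, X j) with sign (-1)^(j+1), and together these give -dτ.
  rw [extChartAt_prod_self, extDeriv_apply hsm, Fin.sum_univ_succ] at hθd
  refine eq_sub_iff_add_eq.1 (hθd.trans ?_)
  have hτd' := (DForm.d_apply τ x X).trans (extDeriv_apply hτd X)
  rw [hτd']
  refine (congrArg₂ (fun a b : ℝ => a + b) ?_ ?_).trans (sub_eq_add_neg (_ : ℝ) _).symm
  · simp only [Fin.val_zero, pow_zero, one_smul]
    rfl
  · rw [← Finset.sum_neg_distrib]
    refine Finset.sum_congr rfl fun j _ => ?_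
    rw [Fin.val_succ, pow_succ, mul_neg_one, neg_smul]
    refine congrArg (fun a : ℝ => -((-1 : ℤ) ^ (j : ℕ) • a)) ?_
    refine Eq.trans ?_ (hr (j.removeNth X) (X j))
    have hv : (j.succ.removeNth (Matrix.vecCons ((v, 0) : E × F) (fun i => ((0, X i) : E × F))))
        = Matrix.vecCons ((v, 0) : E × F) (fun i => ((0, j.removeNth X i) : E × F)) := by
      funext i
      refine Fin.cases ?_ (fun i => ?_) i
      · rfl
      · change Matrix.vecCons ((v, 0) : E × F) (fun i => ((0, X i) : E × F))
          (j.succ.succAbove i.succ) = _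
        rw [Fin.succ_succAbove_succ]
        rfl
    exact congrArg (fun w => fderiv ℝ (fun p => θ.inChart (g, x) p w)
      (extChartAt I g g, extChartAt J x x) (0, X j)) hv

end ProductCharts

/-! ### Alternating forms of degree one and two on explicit tuples -/

section AlternatingAlgebra

variable {T : Type*} [AddCommGroup T] [Module ℝ T] [TopologicalSpace T]

theorem ContinuousAlternatingMap.map_pair_add_left (A : T [⋀^Fin 2]→L[ℝ] ℝ) (a b c : T) :
    A ![a + b, c] = A ![a, c] + A ![b, c] :=
  A.toMultilinearMap.cons_add ![c] a b

theorem ContinuousAlternatingMap.map_pair_swap (A : T [⋀^Fin 2]→L[ℝ] ℝ) (a b : T) :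
    A ![a, b] = -A ![b, a] := by
  have h := A.toAlternatingMap.map_swap ![b, a] (i := 0) (j := 1) (by decide)
  have he : ![a, b] = ![b, a] ∘ Equiv.swap 0 1 := by
    funext i
    fin_cases i <;> rfl
  rw [he]
  exact h

theorem ContinuousAlternatingMap.map_single_add (A : T [⋀^Fin 1]→L[ℝ] ℝ) (a b : T) :
    A ![a + b] = A ![a] + A ![b] :=
  A.toMultilinearMap.cons_add ![] a b

theorem ContinuousAlternatingMap.map_single_smul (A : T [⋀^Fin 1]→L[ℝ] ℝ) (c : ℝ) (a : T) :
    A ![c • a] = c * A ![a] :=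
  A.toMultilinearMap.cons_smul ![] c a

theorem ContinuousAlternatingMap.map_single_zero (A : T [⋀^Fin 1]→L[ℝ] ℝ) :
    A ![0] = 0 :=
  A.map_coord_zero 0 rfl

end AlternatingAlgebra

/-! ### Functions with zero derivative on a connected manifold -/

section Connected

variable {E : Type*} [NormedAddCommGroup E] [NormedSpace ℝ E]
  {K : Type*} [TopologicalSpace K] {I : ModelWithCorners ℝ E K} [I.Boundaryless]
  {G : Type*} [TopologicalSpace G] [ChartedSpace K G] [IsManifold I 1 G]

/-- On a ball inside a chart target the function is constant, being differentiable with zero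
derivative on a connected open set; hence it is locally constant. -/
theorem eq_of_hasMFDerivAt_zero [PreconnectedSpace G] {f : G → ℝ}
    (hf : ∀ g, HasMFDerivAt I 𝓘(ℝ, ℝ) f g 0) (a b : G) : f a = f b := by
  refine IsLocallyConstant.apply_eq_of_preconnectedSpace ?_ a b
  rw [IsLocallyConstant.iff_eventually_eq]
  intro g
  have ht : (extChartAt I g).target ∈ nhds (extChartAt I g g) := extChartAt_target_mem_nhds g
  obtain ⟨r, hr, hball⟩ := Metric.mem_nhds_iff.1 ht
  have hd : ∀ y ∈ Metric.ball (extChartAt I g g) r,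
      HasFDerivAt (f ∘ (extChartAt I g).symm) (0 : E →L[ℝ] ℝ) y := by
    intro y hy
    have h := (hf ((extChartAt I g).symm y)).comp y
      (mdifferentiableAt_extChartAt_symm (hball hy)).hasMFDerivAt
    have h₀ : (0 : TangentSpace I ((extChartAt I g).symm y) →L[ℝ]
        TangentSpace 𝓘(ℝ, ℝ) (f ((extChartAt I g).symm y))).comp
        (mfderiv 𝓘(ℝ, E) I (extChartAt I g).symm y) = 0 := ContinuousLinearMap.zero_comp _
    rw [h₀] at h
    exact h.hasFDerivAt
  have hc : ∀ y ∈ Metric.ball (extChartAt I g g) r,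
      (f ∘ (extChartAt I g).symm) y = (f ∘ (extChartAt I g).symm) (extChartAt I g g) := by
    intro y hy
    exact Metric.isOpen_ball.is_const_of_fderiv_eq_zero (convex_ball _ _).isPreconnected
      (fun z hz => (hd z hz).differentiableAt.differentiableWithinAt)
      (fun z hz => (hd z hz).fderiv) hy (Metric.mem_ball_self hr)
  have hcont := (continuousAt_extChartAt (I := I) g).eventually_mem
    (Metric.isOpen_ball.mem_nhds (Metric.mem_ball_self hr))
  filter_upwards [hcont, (isOpen_extChartAt_source (I := I) g).mem_nhds (mem_extChartAt_source g)]
    with g' hg' hs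
  have h := hc _ hg'
  simp only [Function.comp_apply, (extChartAt I g).left_inv hs, extChartAt_to_inv] at h
  exact h

end Connected

/-! ### Functoriality of pull-back -/

section Pullback

variable {E : Type*} [NormedAddCommGroup E] [NormedSpace ℝ E]
  {K : Type*} [TopologicalSpace K] {I : ModelWithCorners ℝ E K}
  {F : Type*} [NormedAddCommGroup F] [NormedSpace ℝ F]
  {L : Type*} [TopologicalSpace L] {J : ModelWithCorners ℝ F L}
  {E' : Type*} [NormedAddCommGroup E'] [NormedSpace ℝ E'] {K' : Type*} [TopologicalSpace K']
  {I' : ModelWithCorners ℝ E' K'}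
  {M : Type*} [TopologicalSpace M] [ChartedSpace K M]
  {N : Type*} [TopologicalSpace N] [ChartedSpace L N]
  {P : Type*} [TopologicalSpace P] [ChartedSpace K' P] {k : ℕ}

theorem DForm.pullback_sub (f : M → N) (θ η : DForm J N k) :
    DForm.pullback I J f (θ - η) = DForm.pullback I J f θ - DForm.pullback I J f η := by
  funext x; ext v; rfl

theorem DForm.pullback_id (θ : DForm I M k) : DForm.pullback I I (fun x : M => x) θ = θ := by
  funext x
  ext v
  refine DForm.congr_vec θ x fun i => ?_
  change (mfderiv I I (id : M → M) x (v i) : E) = v i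
  rw [mfderiv_id]
  rfl

theorem DForm.pullback_pullback {f : M → N} {g : N → P} (h : M → P)
    (hg : ∀ y, MDifferentiableAt J I' g y) (hf : ∀ x, MDifferentiableAt I J f x)
    (hh : ∀ z, h z = g (f z)) (θ : DForm I' P k) :
    DForm.pullback I J f (DForm.pullback J I' g θ) = DForm.pullback I I' h θ := by
  obtain rfl : h = g ∘ f := funext hh
  funext x
  ext v
  exact DForm.congr_vec θ _ fun i => (mfderiv_apply_of_comp_eq rfl (hg _) (hf x) hh (v i)).symm

end Pullback

/-! ### The equivalent conditions for a given associated form -/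

section Equivalence

variable {E : Type*} [NormedAddCommGroup E] [NormedSpace ℝ E]
  {K : Type*} [TopologicalSpace K] {I : ModelWithCorners ℝ E K}
  {F : Type*} [NormedAddCommGroup F] [NormedSpace ℝ F]
  {L : Type*} [TopologicalSpace L] {J : ModelWithCorners ℝ F L}
  {G : Type*} [TopologicalSpace G] [ChartedSpace K G] [Group G] [LieGroup I ∞ G]
  {M : Type*} [TopologicalSpace M] [ChartedSpace L M]
  [MulAction G M] [ContMDiffSMul I J ∞ G M]
  {ρs : GroupLieAlgebra I G →ₗ[ℝ] DForm J M 1} {φ : DForm J M 3}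
  {θ : DForm (I.prod J) (G × M) 2} {k : ℕ}

/-- At a unit ds kills (v, 0), while dt sends it to ρ(v) and fixes each X. Thus δ linearises to the
contraction term -i_v of the Cartan differential. -/
theorem simpD₀_apply_unit (a : DForm J M (k + 1)) (x : M) (v : GroupLieAlgebra I G)
    (X : Fin k → TangentSpace J x) :
    simpD₀ I G a (1, x) (Matrix.vecCons (pairVec (I := I) (g := 1) v 0)
      (fun i => pairVec (I := I) (g := 1) 0 (X i)))
      = -DForm.contract (infAction I J v) a x X := by
  have h₁ : DForm.pullback (I.prod J) J (actSource (G := G) (M := M)) a (1, x)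
      (Matrix.vecCons (pairVec (I := I) (g := 1) v 0)
        (fun i => pairVec (I := I) (g := 1) 0 (X i))) = 0 :=
    (a x).map_coord_zero 0 (mfderiv_actSource (I := I) (J := J) 1 x v 0)
  have h₂ : DForm.pullback (I.prod J) J (actTarget (G := G) (M := M)) a (1, x)
      (Matrix.vecCons (pairVec (I := I) (g := 1) v 0)
        (fun i => pairVec (I := I) (g := 1) 0 (X i))) = DForm.contract (infAction I J v) a x X := by
    refine (DForm.apply_congr_point a (one_smul G x) _).trans (DForm.congr_vec a _ fun i => ?_)
    refine Fin.cases ?_ (fun i => ?_) i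
    · refine ((mfderiv_actTarget (I := I) (J := J) 1 x v 0).trans
        (mfderiv_one_smul_apply (G := G) x _)).trans ?_
      exact (zero_add _).trans
        (congrArg (fun w => infAction I J w x) (maurerCartan_one (I := I) (E := E) v))
    · refine ((mfderiv_actTarget (I := I) (J := J) 1 x 0 (X i)).trans
        (mfderiv_one_smul_apply (G := G) x _)).trans ?_
      refine (congrArg (fun w => X i + infAction I J w x) (maurerCartan_zero (I := I) 1)).trans ?_
      exact (congrArg (fun w => X i + w) (infAction_zero x)).trans (add_zero _)
  exact (congrArg₂ (fun a b : ℝ => a - b) h₁ h₂).trans (zero_sub _)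

theorem IsMultiplicative.unit_apply_pair (hm : IsMultiplicative θ)
    (hu : ∀ (x : M) (v : GroupLieAlgebra I G) (X : TangentSpace J x),
      θ ((1 : G), x) ![pairVec (g := (1 : G)) (x := x) v 0, pairVec (g := (1 : G)) (x := x) 0 X]
        = ρs v x ![X]) (x : M) (v w : GroupLieAlgebra I G) (X : TangentSpace J x) :
    θ (1, x) ![pairVec (I := I) (g := 1) v 0, pairVec (I := I) (g := 1) w X]
      = ρs v x ![X + infAction I J w x] := by
  have h := hm.apply_unit_update x 0 ![v, w] ![0, X] rfl
  refine Eq.trans (DForm.congr_vec θ _ fun i => ?_) (h.trans (Eq.trans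
    (DForm.congr_vec θ _ fun i => ?_) (hu x v (X + infAction I J w x))))
  · fin_cases i <;> rfl
  · fin_cases i
    · exact Prod.ext rfl ((zero_add _).trans (infAction_zero x))
    · rfl

/-- After moving to the unit, expand in v + X and v' + X'. The (X, X') term vanishes by hypothesis,
and the values against (v, 0) and (v', 0) are given by ρ^*, the pair (v, v') contributing ρ^*(v) on
ρ(v'). -/
theorem hasExplicitFormula_of_vanishesOnSlices (hθ : IsAssociatedForm ρs φ θ)
    (hs : VanishesOnSlices θ) : HasExplicitFormula ρs θ := by
  intro g x V V' X X'
  set v := maurerCartan g V with hv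
  set v' := maurerCartan g V' with hv'
  have hu := IsMultiplicative.unit_apply_pair hθ.multiplicative hθ.atUnits x
  have h₁ : θ (g, x) ![pairVec V X, pairVec V' X']
      = θ (1, x) ![pairVec (I := I) (g := 1) v X, pairVec (I := I) (g := 1) v' X'] := by
    have h := hθ.multiplicative.apply_eq_unit hs g x ![V, V'] ![X, X']
    refine Eq.trans (DForm.congr_vec θ _ fun i => ?_) (h.trans (DForm.congr_vec θ _ fun i => ?_))
    · fin_cases i <;> rfl
    · fin_cases i <;> rfl
  have h₂ : pairVec (I := I) (J := J) (g := 1) (x := x) v X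
      = pairVec (I := I) (g := 1) v 0 + pairVec (I := I) (g := 1) 0 X :=
    Prod.ext (add_zero _).symm (zero_add _).symm
  have h₃ : pairVec (I := I) (J := J) (g := 1) (x := x) v' X'
      = pairVec (I := I) (g := 1) v' 0 + pairVec (I := I) (g := 1) 0 X' :=
    Prod.ext (add_zero _).symm (zero_add _).symm
  have h₄ : θ (1, x) ![pairVec (I := I) (g := 1) 0 X', pairVec (I := I) (g := 1) 0 X] = 0 := by
    refine Eq.trans (DForm.congr_vec θ _ fun i => ?_) (hs.apply 1 x ![X', X])
    fin_cases i <;> rfl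
  rw [h₁, h₂, ContinuousAlternatingMap.map_pair_add_left, hu,
    ContinuousAlternatingMap.map_pair_swap _ (pairVec 0 X), h₃,
    ContinuousAlternatingMap.map_pair_add_left, h₄, hθ.atUnits,
    ContinuousAlternatingMap.map_single_add]
  ring

theorem vanishesOnSlices_of_hasExplicitFormula (hθ : HasExplicitFormula ρs θ) :
    VanishesOnSlices θ := by
  rw [vanishesOnSlices_iff]
  intro g x X
  have h := hθ g x 0 0 (X 0) (X 1)
  rw [maurerCartan_zero, map_zero] at h
  refine Eq.trans (DForm.congr_vec θ _ fun i => ?_) (h.trans ?_)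
  · fin_cases i <;> rfl
  · change (0 : ℝ) + 0 - 0 = 0
    norm_num

theorem HasExplicitFormula.apply_left (hθ : HasExplicitFormula ρs θ) (g : G) (x : M)
    (V : TangentSpace I g) (X : TangentSpace J x) :
    θ (g, x) ![pairVec V 0, pairVec 0 X] = ρs (maurerCartan g V) x ![X] := by
  rw [hθ, maurerCartan_zero, infAction_zero, ContinuousAlternatingMap.map_single_zero,
    ContinuousAlternatingMap.map_single_zero, zero_add, sub_zero]

/-- Constant sections already give the pointwise statement. -/
theorem SkewCondition.apply_const (h : SkewCondition ρs) (v w : GroupLieAlgebra I G) (x : M) :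
    ρs v x ![infAction I J w x] = -ρs w x ![infAction I J v x] := by
  have h₀ := congrArg (fun A : TangentSpace J x [⋀^Fin 0]→L[ℝ] ℝ => A ![])
    (congrFun (h (fun _ => w) (fun _ => v) contMDiff_const contMDiff_const) x)
  exact h₀

/-- By skewness the two half terms of the compact formula coincide and add up to ⟨ρ^*λV, ρλV'⟩. -/
theorem hasCompactFormula_iff_hasExplicitFormula
    (h : ∀ (v w : GroupLieAlgebra I G) (x : M),
      ρs v x ![infAction I J w x] = -ρs w x ![infAction I J v x]) :
    HasCompactFormula ρs θ ↔ HasExplicitFormula ρs θ := by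
  refine forall₂_congr fun g x => forall₂_congr fun V V' => forall₂_congr fun X X' => ?_
  rw [ContinuousAlternatingMap.map_single_add, ContinuousAlternatingMap.map_single_smul,
    ContinuousAlternatingMap.map_single_add, ContinuousAlternatingMap.map_single_smul,
    h (maurerCartan g V') (maurerCartan g V) x]
  refine Eq.congr rfl ?_
  ring

section

variable [I.Boundaryless] [J.Boundaryless] [IsManifold J ∞ M]

/-- Contraction of θ with (v, 0) along the unit slice is ρ^*(v), and dθ = δφ contracts there to
-i_vφ. So the first-order variation of the slice restrictions is exactly the defect in the
form-degree-two Cartan equation. -/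
theorem IsAssociatedForm.mfderiv_slice_unit (hθ : IsAssociatedForm ρs φ θ)
    (hρ : ∀ v, DForm.IsSmooth (ρs v)) (x : M) (v : GroupLieAlgebra I G)
    (X : Fin 2 → TangentSpace J x) :
    mfderiv I 𝓘(ℝ, ℝ) (fun g : G => θ (g, x) (fun i => pairVec (J := J) 0 (X i))) 1 v
      = (DForm.d (ρs v) - DForm.contract (infAction I J v) φ) x X := by
  have h := DForm.d_apply_prod hθ.smooth 1 x v (ρs v) (fun x' X => by
    refine Eq.trans (DForm.congr_vec θ _ fun i => ?_) ((hθ.atUnits x' v (X 0)).trans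
      (DForm.congr_vec (ρs v) _ fun i => ?_))
    · fin_cases i <;> rfl
    · fin_cases i; rfl) (hρ v) X
  have h₂ := simpD₀_apply_unit φ x v X
  have h₃ : θ.d = simpD₀ I G φ := hθ.relClosed
  rw [h₃] at h
  refine h.symm.trans ?_
  refine (congrArg (fun a : ℝ => a + (ρs v).d x X) h₂).trans ?_
  exact (add_comm _ _).trans (sub_eq_add_neg _ _).symm

theorem mem_cartanCocycles₃_of_vanishesOnSlices (hθ : IsAssociatedForm ρs φ θ)
    (hρ : ∀ v, DForm.IsSmooth (ρs v)) (hφ : φ.IsSmooth) (hdφ : φ.d = 0)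
    (hskew : SkewCondition ρs) (hs : VanishesOnSlices θ) :
    ((ρs, φ) : CartanCochain₃ I J G M) ∈ cartanCocycles₃ I J G M := by
  have hex := hasExplicitFormula_of_vanishesOnSlices hθ hs
  refine ⟨⟨hρ, hφ, ?_, ?_⟩, ?_⟩
  · intro g v
    funext x
    ext X
    -- At (1, gx)·(g, x) take (Ad_g v, 0) over the identity of M-directions and (0, X) over none of
    -- H. The product vector is right-translated, and its Maurer-Cartan value is Ad_{g⁻¹}Ad_g v = v.
    have h := hθ.multiplicative.apply 1 g x ![adjointAction g v, 0] (fun _ => 0) ![0, X 0]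
    have h₁ := hex.apply_left (1 * g) x
      (mfderiv I I (fun k : G => k * g) 1 (adjointAction (I := I) g v)) (X 0)
    have h₂ : maurerCartan (I := I) (1 * g)
        (mfderiv I I (fun k : G => k * g) 1 (adjointAction (I := I) g v)) = v := by
      refine (maurerCartan_mul_right 1 g _).trans ?_
      exact (congrArg (adjointAction g⁻¹) (maurerCartan_one (I := I) (E := E) _)).trans
        (adjointAction_inv_apply g v)
    rw [h₂] at h₁
    have h₃ := hθ.atUnits (g • x) (adjointAction g v) (mfderiv J J (fun y : M => g • y) x (X 0))
    have h₄ : θ (g, x) (fun i => pairVec 0 (![0, X 0] i)) = 0 := (θ (g, x)).map_coord_zero 0 rfl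
    rw [h₄] at h
    refine Eq.trans ?_ ((h₃.symm.trans ?_).trans (h₁.trans ?_))
    · refine DForm.congr_vec (ρs (adjointAction g v)) _ fun i => ?_
      fin_cases i; rfl
    · refine Eq.trans ?_ (h.symm.trans ?_)
      · refine Eq.trans (DForm.congr_vec θ _ fun i => ?_) (add_zero _).symm
        rw [maurerCartan_zero, infAction_zero, add_zero]
        fin_cases i
        · exact Prod.ext rfl (map_zero (mfderiv J J (fun y : M => g • y) x)).symm
        · rfl
      · refine DForm.congr_vec θ _ fun i => ?_
        rw [map_zero, add_zero]
        fin_cases i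
        · rfl
        · exact Prod.ext (map_zero (mfderiv I I (fun k : G => k * g) 1)) rfl
    · refine DForm.congr_vec (ρs v) _ fun i => ?_
      fin_cases i; rfl
  · intro g
    -- On {g} × M the source is the identity and the target is the action of g, so relative
    -- closedness restricts to 0 = φ - g^*φ.
    have h₁ := DForm.d_pullback hθ.smooth (contMDiff_slice (I := I) (J := J) (M := M) g)
    rw [hs g, DForm.d_zero, hθ.relClosed, DForm.pullback_sub,
      DForm.pullback_pullback (fun x : M => x)
        (fun y => contMDiff_actSource.mdifferentiableAt (by simp))
        (fun y => (contMDiff_slice g).mdifferentiableAt (by simp)) (fun _ => rfl),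
      DForm.pullback_pullback (fun x : M => g • x)
        (fun y => contMDiff_actTarget.mdifferentiableAt (by simp))
        (fun y => (contMDiff_slice g).mdifferentiableAt (by simp)) (fun _ => rfl),
      DForm.pullback_id] at h₁
    exact (sub_eq_zero.1 h₁.symm).symm
  · intro v
    have h₁ : DForm.contract (infAction I J v) (ρs v) = 0 := by
      funext x
      ext X
      have h := hskew.apply_const v v x
      have h₀ : ρs v x ![infAction I J v x] = 0 := by linarith
      refine Eq.trans (DForm.congr_vec (ρs v) x fun i => ?_) h₀
      fin_cases i; rfl
    have h₂ : DForm.d (ρs v) - DForm.contract (infAction I J v) φ = 0 := by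
      funext x
      ext X
      refine (hθ.mfderiv_slice_unit hρ x v X).symm.trans ?_
      have hz : (fun g : G => θ (g, x) (fun i => pairVec (J := J) 0 (X i))) = fun _ => (0 : ℝ) :=
        funext fun g => hs.apply g x X
      rw [hz, mfderiv_const]
      rfl
    change (-DForm.contract (infAction I J v) (ρs v),
      DForm.d (ρs v) - DForm.contract (infAction I J v) φ, φ.d) = 0
    rw [h₁, h₂, hdφ, neg_zero]
    rfl

/-- The slice restrictions form a cocycle in g whose derivative at 1 is zero (`hone`). The cocycle
identity `hmul` carries this to every h (`hall`), and connectedness leaves only the value at 1. -/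
theorem vanishesOnSlices_of_d_eq_contract [PreconnectedSpace G] (hθ : IsAssociatedForm ρs φ θ)
    (hρ : ∀ v, DForm.IsSmooth (ρs v))
    (hd : ∀ v, DForm.d (ρs v) = DForm.contract (infAction I J v) φ) : VanishesOnSlices θ := by
  have hone : ∀ (x : M) (X : Fin 2 → TangentSpace J x), HasMFDerivAt I 𝓘(ℝ, ℝ)
      (fun g : G => θ (g, x) (fun i => pairVec (J := J) 0 (X i))) 1 0 := by
    intro x X
    have h := (DForm.hasMFDerivAt_slice hθ.smooth 1 x X).mdifferentiableAt.hasMFDerivAt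
    refine h.congr_mfderiv ?_
    ext v
    refine (hθ.mfderiv_slice_unit hρ x v X).trans ?_
    rw [hd v, sub_self]
    rfl
  have hmul : ∀ (g h : G) (x : M) (X : Fin 2 → TangentSpace J x),
      θ (g * h, x) (fun i => pairVec (J := J) 0 (X i))
        = θ (g, h • x) (fun i => pairVec (I := I) 0 (mfderiv J J (fun y : M => h • y) x (X i)))
          + θ (h, x) (fun i => pairVec (J := J) 0 (X i)) := by
    intro g h x X
    have h₀ := hθ.multiplicative.apply g h x (fun _ => 0) (fun _ => 0) X
    refine Eq.trans (DForm.congr_vec θ _ fun i => ?_) (h₀.trans (congrArg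
      (fun a : ℝ => a + θ (h, x) (fun i => pairVec (J := J) 0 (X i)))
      (DForm.congr_vec θ _ fun i => ?_)))
    · rw [map_zero, map_zero]
      exact Prod.ext (add_zero _).symm rfl
    · rw [maurerCartan_zero, infAction_zero, add_zero]
  have hall : ∀ (h : G) (x : M) (X : Fin 2 → TangentSpace J x), HasMFDerivAt I 𝓘(ℝ, ℝ)
      (fun g : G => θ (g, x) (fun i => pairVec (J := J) 0 (X i))) h 0 := by
    intro h x X
    have h₁ := hone (h • x) (fun i => mfderiv J J (fun y : M => h • y) x (X i))
    -- Write g = (gh⁻¹)h: the g-dependence then passes through gh⁻¹, which equals 1 at g = h, where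
    -- the derivative is known.
    have h₂ : HasMFDerivAt I 𝓘(ℝ, ℝ) (fun g : G => θ (g, h • x)
        (fun i => pairVec (I := I) 0 (mfderiv J J (fun y : M => h • y) x (X i)))) (h * h⁻¹) 0 := by
      rw [mul_inv_cancel]
      exact h₁
    have h₃ := h₂.comp h (mdifferentiableAt_rightMul I h⁻¹ h).hasMFDerivAt
    have h₄ : HasMFDerivAt I 𝓘(ℝ, ℝ) (fun _ : G => θ (h, x) (fun i => pairVec (J := J) 0 (X i)))
        h 0 := hasMFDerivAt_const _ _
    have h₅ := h₃.add h₄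
    refine (h₅.congr_mfderiv ?_).congr_of_eventuallyEq (Filter.Eventually.of_forall fun g => ?_)
    · refine (add_zero _).trans ?_
      exact ContinuousLinearMap.zero_comp _
    · have h₆ := hmul (g * h⁻¹) h x X
      refine Eq.trans ?_ h₆
      exact DForm.apply_congr_point θ (by rw [inv_mul_cancel_right]) _
  rw [vanishesOnSlices_iff]
  intro g x X
  refine (eq_of_hasMFDerivAt_zero (fun h => hall h x X) g 1).trans ?_
  have h := hmul 1 1 x X
  have h₁ : θ (1 * 1, x) (fun i => pairVec (J := J) 0 (X i))
      = θ (1, x) (fun i => pairVec (J := J) 0 (X i)) :=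
    DForm.apply_congr_point θ (by rw [mul_one]) _
  have h₂ : θ (1, (1 : G) • x)
      (fun i => pairVec (I := I) 0 (mfderiv J J (fun y : M => (1 : G) • y) x (X i)))
      = θ (1, x) (fun i => pairVec (J := J) 0 (X i)) :=
    (DForm.apply_congr_point θ (by rw [one_smul]) _).trans
      (DForm.congr_vec θ _ fun i => Prod.ext rfl (mfderiv_one_smul_apply (F := F) (G := G) x (X i)))
  rw [h₁, h₂] at h
  -- At the pair of units the cocycle identity reads c = c + c.
  exact left_eq_add.1 h

end

end Equivalence

/-! ### Alternating forms from linear and bilinear ones -/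

section AlternatingConstructions

variable {T : Type*} [NormedAddCommGroup T] [NormedSpace ℝ T] [FiniteDimensional ℝ T]

/-- A linear form as an alternating form of degree one. -/
def alternatingOfLinear (l : T →ₗ[ℝ] ℝ) : T [⋀^Fin 1]→L[ℝ] ℝ where
  toFun v := l (v 0)
  map_update_add' v i a b := by
    obtain rfl := Subsingleton.elim i 0
    simp
  map_update_smul' v i c a := by
    obtain rfl := Subsingleton.elim i 0
    simp
  map_eq_zero_of_eq' v i j _ hij := (hij (Subsingleton.elim i j)).elim
  cont := (LinearMap.continuous_of_finiteDimensional l).comp (continuous_apply 0)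

/-- The skew-symmetrisation of a bilinear form. -/
def alternatingOfBilinear (b : T →ₗ[ℝ] T →ₗ[ℝ] ℝ) : T [⋀^Fin 2]→L[ℝ] ℝ where
  toFun v := b (v 0) (v 1) - b (v 1) (v 0)
  map_update_add' v i x y := by
    obtain rfl | rfl : i = 0 ∨ i = 1 := by omega
    · simp; ring
    · simp; ring
  map_update_smul' v i c x := by
    obtain rfl | rfl : i = 0 ∨ i = 1 := by omega
    · simp; ring
    · simp; ring
  map_eq_zero_of_eq' v i j h hij := by
    have h₀ : v 0 = v 1 := by
      obtain rfl | rfl : i = 0 ∨ i = 1 := by omega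
      · obtain rfl : j = 1 := by omega
        exact h
      · obtain rfl : j = 0 := by omega
        exact h.symm
    change b (v 0) (v 1) - b (v 1) (v 0) = 0
    rw [h₀, sub_self]
  cont := by
    let B : T →L[ℝ] T →L[ℝ] ℝ := LinearMap.toContinuousLinearMap
      ((LinearMap.toContinuousLinearMap : (T →ₗ[ℝ] ℝ) ≃ₗ[ℝ] T →L[ℝ] ℝ).toLinearMap ∘ₗ b)
    have hB : ∀ i j : Fin 2, Continuous fun v : Fin 2 → T => B (v i) (v j) := fun i j =>
      (B.continuous.comp (continuous_apply i)).clm_apply (continuous_apply j)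
    exact (hB 0 1).sub (hB 1 0)

end AlternatingConstructions

/-! ### Smoothness of the Maurer-Cartan form -/

section MaurerCartanSmooth

variable {E : Type*} [NormedAddCommGroup E] [NormedSpace ℝ E]
  {K : Type*} [TopologicalSpace K] {I : ModelWithCorners ℝ E K} [I.Boundaryless]
  {G : Type*} [TopologicalSpace G] [ChartedSpace K G] [Group G] [LieGroup I ∞ G]

/-- The Maurer-Cartan form in a chart. -/
def maurerCartanInChart (I : ModelWithCorners ℝ E K) (g₀ : G) (y a : E) : E :=
  maurerCartan (I := I) ((extChartAt I g₀).symm y)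
    (mfderiv 𝓘(ℝ, E) I (extChartAt I g₀).symm y a)

/-- In coordinates λ is the derivative of y' ↦ y⁻¹y' on the diagonal y' = y, a partial derivative of
the smooth two-variable map `Ψ`, hence smooth in y. -/
theorem contDiffAt_maurerCartanInChart {g₀ : G} {y₀ : E} (hy₀ : y₀ ∈ (extChartAt I g₀).target)
    (a : E) : ContDiffAt ℝ ∞ (fun y => maurerCartanInChart I g₀ y a) y₀ := by
  set s := (extChartAt I g₀).symm with hs
  let Ψ : E → E → E := fun y y' => extChartAt I (1 : G) ((s y)⁻¹ * s y')
  have hsm : ∀ y ∈ (extChartAt I g₀).target, ContMDiffAt 𝓘(ℝ, E) I ∞ s y := fun y hy =>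
    contMDiffAt_extChartAt_symm' hy
  have hψ : ContMDiffAt I 𝓘(ℝ, E) ∞ (extChartAt I (1 : G)) 1 := contMDiffAt_extChartAt
  have hΨ : ContDiffAt ℝ ∞ (Function.uncurry Ψ) (y₀, y₀) := by
    rw [← contMDiffAt_iff_contDiffAt]
    have h₁ : ContMDiffAt 𝓘(ℝ, E × E) I ∞ (fun p : E × E => (s p.1)⁻¹ * s p.2) (y₀, y₀) :=
      (ContMDiffAt.comp (y₀, y₀) (hsm y₀ hy₀) contDiffAt_fst.contMDiffAt).inv.mul
        (ContMDiffAt.comp (y₀, y₀) (hsm y₀ hy₀) contDiffAt_snd.contMDiffAt)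
    refine ContMDiffAt.comp (y₀, y₀) (g := extChartAt I (1 : G)) ?_ h₁
    simp only [inv_mul_cancel]
    exact hψ
  have hfd : ContDiffAt ℝ ∞ (fun y => fderiv ℝ (Ψ y) y) y₀ :=
    ContDiffAt.fderiv (m := ∞) (n := ∞) hΨ contDiffAt_id (by simp)
  refine (hfd.clm_apply contDiffAt_const).congr_of_eventuallyEq (f := fun y => fderiv ℝ (Ψ y) y a) ?_
  filter_upwards [(isOpen_extChartAt_target g₀).mem_nhds hy₀] with y hy
  have h₁ : MDifferentiableAt 𝓘(ℝ, E) I s y := (hsm y hy).mdifferentiableAt (by simp)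
  have h₂ : MDifferentiableAt 𝓘(ℝ, E) I (fun y' => (s y)⁻¹ * s y') y :=
    (mdifferentiableAt_leftMul I _ _).comp y h₁
  have c₁ := mfderiv_apply_of_comp_eq (I := 𝓘(ℝ, E)) (J := I) (I' := I) (f := s)
    (g := fun k => (s y)⁻¹ * k) (h := fun y' => (s y)⁻¹ * s y') (x := y) rfl
    (mdifferentiableAt_leftMul I _ _) h₁ (fun _ => rfl) a
  have c₂ := mfderiv_apply_of_comp_eq (I := 𝓘(ℝ, E)) (J := I) (I' := 𝓘(ℝ, E))
    (f := fun y' => (s y)⁻¹ * s y') (g := extChartAt I (1 : G)) (h := Ψ y) (x := y) (y := 1)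
    (by simp) (hψ.mdifferentiableAt (by simp)) h₂ (fun _ => rfl) a
  -- The chart at 1 has identity derivative at 1, so composing with it does not change the
  -- derivative.
  rw [mfderiv_extChartAt_self, mfderiv_eq_fderiv] at c₂
  exact (c₂.trans c₁).symm

end MaurerCartanSmooth

/-! ### The forms f(λ) and ⟨ρ^*λ, pr + ½ρλ⟩ and their smoothness -/

section Existence

variable {E : Type*} [NormedAddCommGroup E] [NormedSpace ℝ E] [FiniteDimensional ℝ E]
  {K : Type*} [TopologicalSpace K] {I : ModelWithCorners ℝ E K}
  {F : Type*} [NormedAddCommGroup F] [NormedSpace ℝ F] [FiniteDimensional ℝ F]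
  {L : Type*} [TopologicalSpace L] {J : ModelWithCorners ℝ F L}
  {G : Type*} [TopologicalSpace G] [ChartedSpace K G] [Group G] [LieGroup I ∞ G]
  {M : Type*} [TopologicalSpace M] [ChartedSpace L M]
  [MulAction G M] [ContMDiffSMul I J ∞ G M]
  {k : ℕ}

/-- The one-form `(V, X) ↦ f (λ V)` on `H × M`. -/
def mcOneForm (f : GroupLieAlgebra I G →ₗ[ℝ] DForm J M 0) : DForm (I.prod J) (G × M) 1 :=
  fun p => alternatingOfLinear (T := E × F)
    { toFun := fun A => f (maurerCartan (I := I) p.1 A.1) p.2 ![]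
      map_add' := fun A B => by
        rw [Prod.fst_add]
        refine (congrArg (fun v => f v p.2 ![]) (maurerCartan_add (I := I) p.1 A.1 B.1)).trans ?_
        rw [map_add]
        rfl
      map_smul' := fun c A => by
        rw [Prod.smul_fst]
        refine (congrArg (fun v => f v p.2 ![]) (maurerCartan_smul (I := I) p.1 c A.1)).trans ?_
        rw [map_smul]
        rfl }

/-- The two-form `⟨ρ^* λ, pr + ½ ρ λ⟩` on `H × M`. -/
def mcTwoForm (ρs : GroupLieAlgebra I G →ₗ[ℝ] DForm J M 1) : DForm (I.prod J) (G × M) 2 :=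
  fun p => alternatingOfBilinear (T := E × F) (LinearMap.mk₂ ℝ
    (fun A B => ρs (maurerCartan (I := I) p.1 A.1) p.2
      ![id (α := TangentSpace J p.2) B.2 + (1 / 2 : ℝ) • infAction I J (maurerCartan p.1 B.1) p.2])
    (fun A A' B => by
      rw [Prod.fst_add]
      refine (congrArg (fun v => ρs v p.2 _) (maurerCartan_add (I := I) p.1 A.1 A'.1)).trans ?_
      rw [map_add]
      rfl)
    (fun c A B => by
      rw [Prod.smul_fst]
      refine (congrArg (fun v => ρs v p.2 _) (maurerCartan_smul (I := I) p.1 c A.1)).trans ?_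
      rw [map_smul]
      rfl)
    (fun A B B' => by
      refine Eq.trans ?_ (ContinuousAlternatingMap.map_single_add _ _ _)
      congr 2
      refine (congrArg (fun v => id (α := TangentSpace J p.2) (B + B').2 + (1 / 2 : ℝ) •
        infAction I J v p.2) (maurerCartan_add (I := I) p.1 B.1 B'.1)).trans ?_
      rw [infAction_add, smul_add]
      exact add_add_add_comm _ _ _ _)
    (fun c A B => by
      refine Eq.trans ?_ (ContinuousAlternatingMap.map_single_smul _ _ _)
      congr 2
      refine (congrArg (fun v => id (α := TangentSpace J p.2) (c • B).2 + (1 / 2 : ℝ) •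
        infAction I J v p.2) (maurerCartan_smul (I := I) p.1 c B.1)).trans ?_
      rw [infAction_smul_left, smul_comm]
      exact (smul_add _ _ _).symm))

/-- The compact formula serves as definition because it is alternating for every linear ρ^*; the
explicit one is so only under skewness. -/
theorem hasCompactFormula_mcTwoForm (ρs : GroupLieAlgebra I G →ₗ[ℝ] DForm J M 1) :
    HasCompactFormula ρs (mcTwoForm ρs) := fun _ _ _ _ _ _ => rfl

section Smooth

variable [I.Boundaryless] [J.Boundaryless] [IsManifold J ∞ M]

theorem mem_extChartAt_prod_target {g : G} {x : M} {p : E × F}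
    (hp : p ∈ (extChartAt (I.prod J) (g, x)).target) :
    p.1 ∈ (extChartAt I g).target ∧ p.2 ∈ (extChartAt J x).target := by
  rw [extChartAt_prod] at hp
  exact hp

variable (I G) in
/-- A basis of the Lie algebra. -/
def lieAlgebraBasis (i : Fin (Module.finrank ℝ E)) : GroupLieAlgebra I G :=
  (Module.finBasis ℝ E i : E)

theorem sum_coord_smul_maurerCartanInChart (g₀ : G) (y a : E) :
    maurerCartanInChart I g₀ y a = ∑ i, (LinearMap.toContinuousLinearMap
      ((Module.finBasis ℝ E).coord i) (maurerCartanInChart I g₀ y a)) • Module.finBasis ℝ E i :=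
  ((Module.finBasis ℝ E).sum_repr _).symm

/-- A basis of 𝔥 separates the variables: coefficients of λ depend on the group coordinate only, the
fixed forms ρ^*(eᵢ) on the point of `M` only. -/
theorem apply_maurerCartanInChart (ρs : GroupLieAlgebra I G →ₗ[ℝ] DForm J M k) (g₀ : G) (y a : E)
    (x : M) (X : Fin k → TangentSpace J x) :
    ρs (maurerCartanInChart (E := E) I g₀ y a) x X = ∑ i, (LinearMap.toContinuousLinearMap
      ((Module.finBasis ℝ E).coord i) (maurerCartanInChart I g₀ y a)) *
        ρs (lieAlgebraBasis I G i) x X := by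
  let ev : GroupLieAlgebra I G →ₗ[ℝ] ℝ :=
    { toFun := fun v => ρs v x X
      map_add' := fun v w => by rw [map_add]; rfl
      map_smul' := fun c v => by rw [map_smul]; rfl }
  have h := congrArg (fun v : E => ev v) (sum_coord_smul_maurerCartanInChart (I := I) g₀ y a)
  refine h.trans ((map_sum ev _ _).trans (Finset.sum_congr rfl fun i _ => ?_))
  exact ev.map_smul _ _

theorem contDiffAt_coord_maurerCartanInChart {g₀ : G} {p : E × F}
    (hp : p.1 ∈ (extChartAt I g₀).target) (a : E) (l : E →L[ℝ] ℝ) :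
    ContDiffAt ℝ ∞ (fun q : E × F => l (maurerCartanInChart I g₀ q.1 a)) p :=
  l.contDiff.contDiffAt.comp p
    (ContDiffAt.comp p (contDiffAt_maurerCartanInChart hp a) contDiffAt_fst)

theorem isSmooth_mcOneForm {f : GroupLieAlgebra I G →ₗ[ℝ] DForm J M 0}
    (hf : ∀ v, DForm.IsSmooth (f v)) : DForm.IsSmooth (mcOneForm f) := by
  refine DForm.isSmooth_of_contDiffAt fun ⟨g₀, x₀⟩ p hp => ?_
  refine contDiffAt_alternating_of_apply fun A => ?_
  have hp' := mem_extChartAt_prod_target hp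
  have hev : (fun q => (mcOneForm f).inChart (g₀, x₀) q A) =ᶠ[nhds p]
      fun q => ∑ i, (LinearMap.toContinuousLinearMap ((Module.finBasis ℝ E).coord i)
        (maurerCartanInChart I g₀ q.1 (A 0).1)) *
        (f (lieAlgebraBasis I G i)).inChart x₀ q.2 ![] := by
    filter_upwards [(isOpen_extChartAt_target (I := I.prod J) (g₀, x₀)).mem_nhds hp] with q hq
    have hq' := mem_extChartAt_prod_target hq
    refine (DForm.inChart_prod_apply _ hq'.1 hq'.2 A).trans ?_
    refine (apply_maurerCartanInChart f g₀ q.1 (A 0).1 ((extChartAt J x₀).symm q.2) ![]).trans ?_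
    refine Finset.sum_congr rfl fun i _ => ?_
    refine congrArg (fun r : ℝ => _ * r) (DForm.congr_vec _ _ fun i => i.elim0)
  refine ContDiffAt.congr_of_eventuallyEq ?_ hev
  refine ContDiffAt.sum fun i _ => (contDiffAt_coord_maurerCartanInChart hp'.1 _ _).mul ?_
  exact ContDiffAt.comp p (((hf _).contDiffAt hp'.2).alternating_apply _) contDiffAt_snd

/-- The function η(ρ(w)) is t^*η evaluated on (w, 0) at the units, so it inherits smoothness from
the pull-back along the target map. -/
theorem contDiffAt_apply_infAction {η : DForm J M 1} (hη : η.IsSmooth) (w : GroupLieAlgebra I G)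
    {x₀ : M} {z₀ : F} (hz₀ : z₀ ∈ (extChartAt J x₀).target) :
    ContDiffAt ℝ ∞ (fun z => η ((extChartAt J x₀).symm z)
      ![infAction I J w ((extChartAt J x₀).symm z)]) z₀ := by
  set t := DForm.pullback (I.prod J) J (actTarget (G := G) (M := M)) η with ht
  have hts : t.IsSmooth := hη.pullback contMDiff_actTarget
  have hmem : (extChartAt I (1 : G) 1, z₀) ∈ (extChartAt (I.prod J) ((1 : G), x₀)).target := by
    rw [extChartAt_prod]
    exact ⟨mem_extChartAt_target 1, hz₀⟩
  have h₁ : ContDiffAt ℝ ∞ (fun z => t.inChart ((1 : G), x₀) (extChartAt I (1 : G) 1, z)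
      ![((w, 0) : E × F)]) z₀ :=
    ContDiffAt.comp z₀ ((hts.contDiffAt hmem).alternating_apply _)
      (contDiffAt_const.prodMk contDiffAt_id)
  refine h₁.congr_of_eventuallyEq ?_
  filter_upwards [(isOpen_extChartAt_target x₀).mem_nhds hz₀] with z hz
  set x := (extChartAt J x₀).symm z with hx
  rw [DForm.inChart_prod_apply t (mem_extChartAt_target 1) hz]
  refine Eq.trans ?_ (DForm.apply_congr_point t (x := ((1 : G), x))
    (by rw [extChartAt_to_inv]) _)
  refine Eq.trans ?_ (DForm.apply_congr_point η (one_smul G x).symm _)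
  refine DForm.congr_vec η x fun i => ?_
  obtain rfl := Subsingleton.elim i 0
  have e : ((mfderiv 𝓘(ℝ, E) I (extChartAt I (1 : G)).symm (extChartAt I (1 : G) 1) w,
      mfderiv 𝓘(ℝ, F) J (extChartAt J x₀).symm z 0) : E × F)
      = (w, 0) := Prod.ext (mfderiv_extChartAt_symm_self (I := I) 1 w)
        (map_zero (mfderiv 𝓘(ℝ, F) J (extChartAt J x₀).symm z))
  refine Eq.symm ((congrArg (fun A : E × F => (mfderiv (I.prod J) J
    (actTarget (G := G) (M := M)) (1, x) A : F)) e).trans ?_)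
  refine ((mfderiv_actTarget (I := I) (J := J) 1 x w 0).trans
    (mfderiv_one_smul_apply (F := F) (G := G) x _)).trans ?_
  exact (zero_add _).trans
    (congrArg (fun w => infAction I J w x) (maurerCartan_one (I := I) (E := E) w))

theorem isSmooth_mcTwoForm {ρs : GroupLieAlgebra I G →ₗ[ℝ] DForm J M 1}
    (hρ : ∀ v, DForm.IsSmooth (ρs v)) : DForm.IsSmooth (mcTwoForm ρs) := by
  refine DForm.isSmooth_of_contDiffAt fun ⟨g₀, x₀⟩ p hp => ?_
  refine contDiffAt_alternating_of_apply fun A => ?_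
  have hp' := mem_extChartAt_prod_target hp
  let l : Fin (Module.finrank ℝ E) → E →L[ℝ] ℝ := fun i =>
    LinearMap.toContinuousLinearMap ((Module.finBasis ℝ E).coord i)
  -- The coordinate expression of the bilinear form before skew-symmetrisation, with both
  -- occurrences of λ expanded in the basis.
  let β : E × F → E × F → E × F → ℝ := fun q A B =>
    ∑ i, l i (maurerCartanInChart I g₀ q.1 A.1) *
      ((ρs (lieAlgebraBasis I G i)).inChart x₀ q.2 ![B.2] + (1 / 2 : ℝ) *
        ∑ j, l j (maurerCartanInChart I g₀ q.1 B.1) *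
          ρs (lieAlgebraBasis I G i) ((extChartAt J x₀).symm q.2)
            ![infAction I J (lieAlgebraBasis I G j) ((extChartAt J x₀).symm q.2)])
  have hβ : ∀ A B : E × F, ContDiffAt ℝ ∞ (fun q => β q A B) p := by
    intro A B
    refine ContDiffAt.sum fun i _ => (contDiffAt_coord_maurerCartanInChart hp'.1 _ _).mul
      (ContDiffAt.add ?_ (contDiffAt_const.mul (ContDiffAt.sum fun j _ =>
        (contDiffAt_coord_maurerCartanInChart hp'.1 _ _).mul ?_)))
    · exact ContDiffAt.comp p (((hρ _).contDiffAt hp'.2).alternating_apply _) contDiffAt_snd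
    · exact ContDiffAt.comp p (contDiffAt_apply_infAction (hρ _) _ hp'.2) contDiffAt_snd
  have hB : ∀ (q : E × F) (A B : E × F),
      ρs (maurerCartanInChart (E := E) I g₀ q.1 A.1) ((extChartAt J x₀).symm q.2)
        ![mfderiv 𝓘(ℝ, F) J (extChartAt J x₀).symm q.2 B.2 + (1 / 2 : ℝ) •
          infAction I J (G := G) (maurerCartanInChart (E := E) I g₀ q.1 B.1)
            ((extChartAt J x₀).symm q.2)]
        = β q A B := by
    intro q A B
    set x := (extChartAt J x₀).symm q.2 with hx
    rw [apply_maurerCartanInChart]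
    refine Finset.sum_congr rfl fun i _ => ?_
    refine congrArg (fun r : ℝ => _ * r) ?_
    rw [ContinuousAlternatingMap.map_single_add, ContinuousAlternatingMap.map_single_smul]
    refine congrArg₂ (fun r s : ℝ => r + (1 / 2 : ℝ) * s) ?_ ?_
    · refine DForm.congr_vec _ _ fun i => ?_
      obtain rfl := Subsingleton.elim i 0
      rfl
    · let ev : GroupLieAlgebra I G →ₗ[ℝ] ℝ :=
        { toFun := fun v => ρs (lieAlgebraBasis I G i) x ![infAction I J v x]
          map_add' := fun v w => by
            rw [infAction_add, ContinuousAlternatingMap.map_single_add]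
          map_smul' := fun c v => by
            rw [infAction_smul_left, ContinuousAlternatingMap.map_single_smul]
            rfl }
      have h := congrArg (fun v : E => ev v)
          (sum_coord_smul_maurerCartanInChart (I := I) g₀ q.1 B.1)
      refine h.trans ((map_sum ev _ _).trans (Finset.sum_congr rfl fun j _ => ?_))
      exact ev.map_smul _ _
  have hev : (fun q => (mcTwoForm ρs).inChart (g₀, x₀) q A) =ᶠ[nhds p]
      fun q => β q (A 0) (A 1) - β q (A 1) (A 0) := by
    filter_upwards [(isOpen_extChartAt_target (I := I.prod J) (g₀, x₀)).mem_nhds hp] with q hq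
    have hq' := mem_extChartAt_prod_target hq
    refine (DForm.inChart_prod_apply _ hq'.1 hq'.2 A).trans ?_
    exact congrArg₂ (fun r s : ℝ => r - s) (hB q (A 0) (A 1)) (hB q (A 1) (A 0))
  exact ((hβ _ _).sub (hβ _ _)).congr_of_eventuallyEq hev

end Smooth

end Existence

/-! ### Criteria for multiplicativity -/

section Cocycle

variable {E : Type*} [NormedAddCommGroup E] [NormedSpace ℝ E]
  {K : Type*} [TopologicalSpace K] {I : ModelWithCorners ℝ E K}
  {F : Type*} [NormedAddCommGroup F] [NormedSpace ℝ F]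
  {L : Type*} [TopologicalSpace L] {J : ModelWithCorners ℝ F L}
  {G : Type*} [TopologicalSpace G] [ChartedSpace K G] [Group G] [LieGroup I ∞ G]
  {M : Type*} [TopologicalSpace M] [ChartedSpace L M]
  [MulAction G M] [ContMDiffSMul I J ∞ G M]
  {ρs : GroupLieAlgebra I G →ₗ[ℝ] DForm J M 1} {φ : DForm J M 3} {k : ℕ}

theorem isMultiplicative_of_apply {θ : DForm (I.prod J) (G × M) k}
    (hθ : ∀ (g h : G) (x : M) (V : Fin k → TangentSpace I g) (W : Fin k → TangentSpace I h)
      (X : Fin k → TangentSpace J x),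
      θ (g * h, x) (fun i => pairVec (I := I) (g := g * h)
          (mfderiv I I (fun k : G => k * h) g (V i) + mfderiv I I (fun k : G => g * k) h (W i))
          (X i))
        = θ (g, h • x) (fun i => pairVec (I := I) (J := J) (g := g) (x := h • x) (V i)
            (mfderiv J J (fun y : M => h • y) x (X i + infAction I J (maurerCartan h (W i)) x)))
          + θ (h, x) (fun i => pairVec (W i) (X i))) : IsMultiplicative θ := by
  funext ⟨g, h, x⟩
  ext A
  let V : Fin k → TangentSpace I g := fun i => (A i).1
  let W : Fin k → TangentSpace I h := fun i => (A i).2.1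
  let X : Fin k → TangentSpace J x := fun i => (A i).2.2
  refine Eq.trans ?_ ((hθ g h x V W X).trans (congrArg₂ (fun a b : ℝ => a + b) ?_ ?_))
  · exact DForm.congr_vec θ _ fun i => mfderiv_actMul g h x (V i) (W i) (X i)
  · exact (DForm.congr_vec θ _ fun i => mfderiv_actPr₁ g h x (V i) (W i) (X i)).symm
  · exact (DForm.congr_vec θ _ fun i => mfderiv_actPr₂ g h x (V i) (W i) (X i)).symm

theorem IsMultiplicative.sub {θ η : DForm (I.prod J) (G × M) k} (hθ : IsMultiplicative θ)
    (hη : IsMultiplicative η) : IsMultiplicative (θ - η) := by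
  unfold IsMultiplicative at *
  rw [DForm.pullback_sub, DForm.pullback_sub, DForm.pullback_sub, hθ, hη]
  abel

theorem VanishesOnSlices.sub {θ η : DForm (I.prod J) (G × M) k} (hθ : VanishesOnSlices θ)
    (hη : VanishesOnSlices η) : VanishesOnSlices (θ - η) := fun g => by
  rw [DForm.pullback_sub, hθ, hη, sub_zero]

theorem isMultiplicative_iff_simpD₁_eq_zero {θ : DForm (I.prod J) (G × M) k} :
    IsMultiplicative θ ↔ simpD₁ θ = 0 := by
  unfold IsMultiplicative simpD₁
  rw [sub_add_eq_add_sub, sub_eq_zero, add_comm, eq_comm]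

/-- This is δδ = 0: the six composites of source and target with the three face maps agree in pairs,
as a product has the source of its second and the target of its first factor, and these two meet in
the middle. -/
theorem isMultiplicative_simpD₀ (a : DForm J M k) : IsMultiplicative (simpD₀ I G a) := by
  unfold IsMultiplicative simpD₀
  have hs : ∀ y, MDifferentiableAt (I.prod J) J (actSource (G := G) (M := M)) y := fun y =>
    contMDiff_actSource.mdifferentiableAt (by simp)
  have ht : ∀ y, MDifferentiableAt (I.prod J) J (actTarget (G := G) (M := M)) y := fun y =>
    contMDiff_actTarget.mdifferentiableAt (by simp)
  have hm : ∀ y, MDifferentiableAt (I.prod (I.prod J)) (I.prod J)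
    (actMul (G := G) (M := M)) y := fun y => contMDiff_actMul.mdifferentiableAt (by simp)
  have h₁ : ∀ y, MDifferentiableAt (I.prod (I.prod J)) (I.prod J)
    (actPr₁ (G := G) (M := M)) y := fun y => contMDiff_actPr₁.mdifferentiableAt (by simp)
  have h₂ : ∀ y, MDifferentiableAt (I.prod (I.prod J)) (I.prod J)
    (actPr₂ (G := G) (M := M)) y := fun y => contMDiff_actPr₂.mdifferentiableAt (by simp)
  rw [DForm.pullback_sub, DForm.pullback_sub, DForm.pullback_sub,
    DForm.pullback_pullback (fun p => p.2.2) hs hm (fun _ => rfl),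
    DForm.pullback_pullback (fun p => p.1 • p.2.1 • p.2.2) ht hm
      (fun p => (mul_smul p.1 p.2.1 p.2.2).symm),
    DForm.pullback_pullback (fun p => p.2.1 • p.2.2) hs h₁ (fun _ => rfl),
    DForm.pullback_pullback (fun p => p.1 • p.2.1 • p.2.2) ht h₁ (fun _ => rfl),
    DForm.pullback_pullback (fun p => p.2.2) hs h₂ (fun _ => rfl),
    DForm.pullback_pullback (fun p => p.2.1 • p.2.2) ht h₂ (fun _ => rfl)]
  abel

theorem vanishesOnSlices_simpD₀ {a : DForm J M k} (ha : IsInvariantForm G a) :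
    VanishesOnSlices (simpD₀ I G a) := by
  intro g
  unfold simpD₀
  rw [DForm.pullback_sub,
    DForm.pullback_pullback (fun x : M => x)
      (fun y => contMDiff_actSource.mdifferentiableAt (by simp))
      (fun y => (contMDiff_slice g).mdifferentiableAt (by simp)) (fun _ => rfl),
    DForm.pullback_pullback (fun x : M => g • x)
      (fun y => contMDiff_actTarget.mdifferentiableAt (by simp))
      (fun y => (contMDiff_slice g).mdifferentiableAt (by simp)) (fun _ => rfl),
    DForm.pullback_id, ha g, sub_self]

/-- Invariance applied to Ad_{h⁻¹}v, in the shape that moves a value at hx back to x. -/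
theorem IsInvariantLinear.apply_smul {P : GroupLieAlgebra I G →ₗ[ℝ] DForm J M k}
    (hP : IsInvariantLinear P) (h : G) (v : GroupLieAlgebra I G) (x : M)
    (Y : Fin k → TangentSpace J x) :
    P v (h • x) (fun i => mfderiv J J (fun y : M => h • y) x (Y i))
      = P (adjointAction h⁻¹ v) x Y := by
  have e : adjointAction h (adjointAction h⁻¹ v) = v := by
    have := adjointAction_inv_apply (I := I) h⁻¹ v
    rwa [inv_inv] at this
  have h₀ := congrArg (fun A : TangentSpace J x [⋀^Fin k]→L[ℝ] ℝ => A Y)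
    (congrFun (hP h (adjointAction h⁻¹ v)) x)
  rw [e] at h₀
  exact h₀

theorem IsInvariantLinear.apply_smul_single (hP : IsInvariantLinear ρs) (h : G)
    (v : GroupLieAlgebra I G) (x : M) (Y : TangentSpace J x) :
    ρs v (h • x) ![mfderiv J J (fun y : M => h • y) x Y] = ρs (adjointAction h⁻¹ v) x ![Y] := by
  refine Eq.trans (DForm.congr_vec (ρs v) _ fun i => ?_) (hP.apply_smul h v x ![Y])
  fin_cases i; rfl

/-- The cocycle property of λ, the source of multiplicativity for every form built from λ and
invariant data. -/
theorem maurerCartan_mul (g h : G) (V W : E) :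
    maurerCartan (I := I) (g * h) ((mfderiv I I (fun k : G => k * h) g V : E)
        + (mfderiv I I (fun k : G => g * k) h W : E))
      = adjointAction h⁻¹ (maurerCartan g V) + maurerCartan h W :=
  (maurerCartan_add (I := I) (g * h) _ _).trans
    (congrArg₂ (fun a b : GroupLieAlgebra I G => a + b) (maurerCartan_mul_right g h V)
      (maurerCartan_mul_left g h W))

theorem HasExplicitFormula.apply {θ : DForm (I.prod J) (G × M) 2} (hθ : HasExplicitFormula ρs θ)
    (g : G) (x : M) (V : Fin 2 → TangentSpace I g) (X : Fin 2 → TangentSpace J x) :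
    θ (g, x) (fun i => pairVec (V i) (X i))
      = ρs (maurerCartan g (V 0)) x ![infAction I J (maurerCartan g (V 1)) x]
        + ρs (maurerCartan g (V 0)) x ![X 1] - ρs (maurerCartan g (V 1)) x ![X 0] := by
  refine Eq.trans (DForm.congr_vec θ _ fun i => ?_) (hθ g x (V 0) (V 1) (X 0) (X 1))
  fin_cases i <;> rfl

theorem DForm.map_add_apply (P : GroupLieAlgebra I G →ₗ[ℝ] DForm J M k)
    (v w : GroupLieAlgebra I G) (x : M) (X : Fin k → TangentSpace J x) :
    P (v + w) x X = P v x X + P w x X := by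
  rw [map_add]; rfl

/-- With a = Ad_{h⁻¹}λ_gV and b = λ_hW, invariance and equivariance of ρ bring all terms to x.
Everything then matches by bilinearity except a cross term: ⟨ρ^*(b), ρ(a')⟩ against -⟨ρ^*(a'),
ρ(b)⟩, which is skewness. -/
theorem HasExplicitFormula.isMultiplicative {θ : DForm (I.prod J) (G × M) 2}
    (hθ : HasExplicitFormula ρs θ) (hinv : IsInvariantLinear ρs)
    (hskew : ∀ (v w : GroupLieAlgebra I G) (x : M),
      ρs v x ![infAction I J w x] = -ρs w x ![infAction I J v x]) : IsMultiplicative θ := by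
  refine isMultiplicative_of_apply fun g h x V W X => ?_
  have hmc : ∀ i, maurerCartan (I := I) (g * h) ((mfderiv I I (fun k : G => k * h) g (V i) : E)
        + (mfderiv I I (fun k : G => g * k) h (W i) : E))
      = adjointAction h⁻¹ (maurerCartan g (V i)) + maurerCartan h (W i) :=
    fun i => maurerCartan_mul (E := E) g h (V i) (W i)
  have h₁ := hθ.apply (g * h) x (fun i => ((mfderiv I I (fun k : G => k * h) g (V i) : E)
        + (mfderiv I I (fun k : G => g * k) h (W i) : E) : E)) X
  have h₂ := hθ.apply g (h • x) V (fun i => mfderiv J J (fun y : M => h • y) x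
    (X i + infAction I J (maurerCartan h (W i)) x))
  have h₃ := hθ.apply h x W X
  beta_reduce at h₁ h₂
  rw [hmc 0, hmc 1] at h₁
  have h₄ : ρs (maurerCartan g (V 0)) (h • x) ![infAction I J (maurerCartan g (V 1)) (h • x)]
      = ρs (adjointAction h⁻¹ (maurerCartan g (V 0))) x
        ![infAction I J (adjointAction h⁻¹ (maurerCartan g (V 1))) x] := by
    refine Eq.trans (DForm.congr_vec (ρs _) _ fun i => ?_)
      (hinv.apply_smul_single h (maurerCartan g (V 0)) x _)
    fin_cases i
    exact infAction_smul (F := F) h (maurerCartan g (V 1)) x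
  rw [h₄, hinv.apply_smul_single, hinv.apply_smul_single,
    ContinuousAlternatingMap.map_single_add, ContinuousAlternatingMap.map_single_add] at h₂
  rw [DForm.map_add_apply, DForm.map_add_apply, DForm.map_add_apply, infAction_add,
    ContinuousAlternatingMap.map_single_add, ContinuousAlternatingMap.map_single_add,
    hskew (maurerCartan h (W 0)) (adjointAction h⁻¹ (maurerCartan g (V 1)))] at h₁
  refine h₁.trans ((?_ : _ = _).trans (congrArg₂ (fun a b : ℝ => a + b) h₂ h₃).symm)
  ring

/-- Polarisation of ⟨ρ^*(u), ρ(u)⟩ = 0 at u = v + w. -/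
theorem skew_of_contract_eq_zero
    (h : ∀ v, DForm.contract (infAction I J v) (ρs v) = 0) (v w : GroupLieAlgebra I G) (x : M) :
    ρs v x ![infAction I J w x] = -ρs w x ![infAction I J v x] := by
  have h₀ : ∀ u : GroupLieAlgebra I G, ρs u x ![infAction I J u x] = 0 := fun u =>
    (DForm.congr_vec (ρs u) x fun i => by fin_cases i; rfl).trans
      (congrArg (fun A : TangentSpace J x [⋀^Fin 0]→L[ℝ] ℝ => A ![]) (congrFun (h u) x))
  have h₁ := h₀ (v + w)
  rw [DForm.map_add_apply, infAction_add, ContinuousAlternatingMap.map_single_add,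
    ContinuousAlternatingMap.map_single_add, h₀ v, h₀ w] at h₁
  linarith

end Cocycle

/-! ### Existence, uniqueness and exactness by rigidity -/

section Smooth

variable {E : Type*} [NormedAddCommGroup E] [NormedSpace ℝ E] [FiniteDimensional ℝ E]
  {K : Type*} [TopologicalSpace K] {I : ModelWithCorners ℝ E K} [I.Boundaryless]
  {F : Type*} [NormedAddCommGroup F] [NormedSpace ℝ F] [FiniteDimensional ℝ F]
  {L : Type*} [TopologicalSpace L] {J : ModelWithCorners ℝ F L} [J.Boundaryless]
  {G : Type*} [TopologicalSpace G] [ChartedSpace K G] [Group G] [LieGroup I ∞ G]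
  {M : Type*} [TopologicalSpace M] [ChartedSpace L M] [IsManifold J ∞ M]
  [MulAction G M] [ContMDiffSMul I J ∞ G M]
  {ρs : GroupLieAlgebra I G →ₗ[ℝ] DForm J M 1} {φ : DForm J M 3} {k : ℕ}

theorem IsMultiplicative.d {θ : DForm (I.prod J) (G × M) k} (hθ : IsMultiplicative θ)
    (hs : θ.IsSmooth) : IsMultiplicative θ.d := by
  unfold IsMultiplicative at *
  rw [← DForm.d_pullback hs contMDiff_actMul, ← DForm.d_pullback hs contMDiff_actPr₁,
    ← DForm.d_pullback hs contMDiff_actPr₂, hθ,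
    DForm.d_add (hs.pullback contMDiff_actPr₁) (hs.pullback contMDiff_actPr₂)]

theorem VanishesOnSlices.d {θ : DForm (I.prod J) (G × M) k} (hθ : VanishesOnSlices θ)
    (hs : θ.IsSmooth) : VanishesOnSlices θ.d := fun g => by
  rw [← DForm.d_pullback hs (contMDiff_slice g), hθ g, DForm.d_zero]

/-- The slice values are identically zero, so their derivative in the group direction drops out of
`DForm.d_apply_prod`. -/
theorem VanishesOnSlices.d_apply_prod {θ : DForm (I.prod J) (G × M) (k + 1)}
    (hθ : VanishesOnSlices θ) (hs : θ.IsSmooth) (g : G) (x : M)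
    (v : TangentSpace I g) (τ : DForm J M k)
    (h : ∀ (x' : M) (X : Fin k → TangentSpace J x'), θ (g, x')
      (Matrix.vecCons (pairVec v 0) (fun i => pairVec (I := I) 0 (X i))) = τ x' X)
    (hτ : τ.IsSmooth) (X : Fin (k + 1) → TangentSpace J x) :
    θ.d (g, x) (Matrix.vecCons (pairVec v 0) (fun i => pairVec (I := I) 0 (X i)))
      = -τ.d x X := by
  have h₁ := DForm.d_apply_prod hs g x v τ h hτ X
  have hz : (fun g : G => θ (g, x) (fun i => pairVec (J := J) 0 (X i))) = fun _ => (0 : ℝ) :=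
    funext fun g => hθ.apply g x X
  rw [hz, mfderiv_const] at h₁
  exact eq_neg_of_add_eq_zero_left h₁

theorem mcTwoForm_apply_unit (hex : HasExplicitFormula ρs (mcTwoForm ρs)) (x : M)
    (v : GroupLieAlgebra I G) (X : TangentSpace J x) :
    mcTwoForm ρs (1, x) ![pairVec (I := I) (g := 1) v 0, pairVec (I := I) (g := 1) 0 X]
      = ρs v x ![X] :=
  (hex.apply_left 1 x v X).trans
    (congrArg (fun v => ρs v x ![X]) (maurerCartan_one (I := I) (E := E) v))

theorem contract_eq_zero_of_mem_cartanCocycles₃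
    (hc : ((ρs, φ) : CartanCochain₃ I J G M) ∈ cartanCocycles₃ I J G M)
    (v : GroupLieAlgebra I G) : DForm.contract (infAction I J v) (ρs v) = 0 :=
  neg_eq_zero.1 (congrArg Prod.fst (hc.2 v))

theorem d_eq_contract_of_mem_cartanCocycles₃
    (hc : ((ρs, φ) : CartanCochain₃ I J G M) ∈ cartanCocycles₃ I J G M)
    (v : GroupLieAlgebra I G) : DForm.d (ρs v) = DForm.contract (infAction I J v) φ :=
  sub_eq_zero.1 (congrArg (fun p => p.2.1) (hc.2 v))

theorem hasExplicitFormula_mcTwoForm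
    (hc : ((ρs, φ) : CartanCochain₃ I J G M) ∈ cartanCocycles₃ I J G M) :
    HasExplicitFormula ρs (mcTwoForm ρs) :=
  (hasCompactFormula_iff_hasExplicitFormula
    (skew_of_contract_eq_zero (contract_eq_zero_of_mem_cartanCocycles₃ hc))).1
    (hasCompactFormula_mcTwoForm ρs)

theorem isAssociatedForm_mcTwoForm
    (hc : ((ρs, φ) : CartanCochain₃ I J G M) ∈ cartanCocycles₃ I J G M) :
    IsAssociatedForm ρs φ (mcTwoForm ρs) := by
  have hex := hasExplicitFormula_mcTwoForm hc
  have hm := hex.isMultiplicative hc.1.inv_lin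
    (skew_of_contract_eq_zero (contract_eq_zero_of_mem_cartanCocycles₃ hc))
  have hs := vanishesOnSlices_of_hasExplicitFormula hex
  have hsm : DForm.IsSmooth (mcTwoForm ρs) := isSmooth_mcTwoForm hc.1.smooth_lin
  refine ⟨hsm, hm, ?_, mcTwoForm_apply_unit hex⟩
  change (mcTwoForm ρs).d = simpD₀ I G φ
  -- Rigidity for dω - δφ: both terms are multiplicative and vanish on slices, the second by
  -- invariance of φ. At units they give -d(ρ^*(v)) and -i_vφ, equal by the Cartan equation.
  refine sub_eq_zero.1 (IsMultiplicative.eq_zero ((hm.d hsm).sub (isMultiplicative_simpD₀ φ))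
    ((hs.d hsm).sub (vanishesOnSlices_simpD₀ hc.1.inv_const)) fun x v X => ?_)
  have h₁ := hs.d_apply_prod hsm 1 x v (ρs v) (fun x' X => by
    refine Eq.trans (DForm.congr_vec _ _ fun i => ?_) ((mcTwoForm_apply_unit hex x' v (X 0)).trans
      (DForm.congr_vec (ρs v) _ fun i => ?_))
    · fin_cases i <;> rfl
    · fin_cases i; rfl) (hc.1.smooth_lin v) X
  rw [d_eq_contract_of_mem_cartanCocycles₃ hc v] at h₁
  exact (congrArg₂ (fun a b : ℝ => a - b) h₁ (simpD₀_apply_unit φ x v X)).trans (sub_self _)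

/-- Connectedness forces any associated form to vanish on slices, hence to satisfy the explicit
formula, which fixes all its values. -/
theorem IsAssociatedForm.eq_mcTwoForm [PreconnectedSpace G]
    (hc : ((ρs, φ) : CartanCochain₃ I J G M) ∈ cartanCocycles₃ I J G M)
    {θ : DForm (I.prod J) (G × M) 2} (hθ : IsAssociatedForm ρs φ θ) : θ = mcTwoForm ρs := by
  have hex := hasExplicitFormula_of_vanishesOnSlices hθ (vanishesOnSlices_of_d_eq_contract hθ
    hc.1.smooth_lin (d_eq_contract_of_mem_cartanCocycles₃ hc))
  funext ⟨g, x⟩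
  ext A
  exact (hex.apply g x (fun i => (A i).1) (fun i => (A i).2)).trans
    ((hasExplicitFormula_mcTwoForm hc).apply g x (fun i => (A i).1) (fun i => (A i).2)).symm

/-- In f(λ_{gh}) = f(Ad_{h⁻¹}λ_g) + f(λ_h) at x, invariance turns the first term into f(λ_g) at hx.
-/
theorem isMultiplicative_mcOneForm {f : GroupLieAlgebra I G →ₗ[ℝ] DForm J M 0}
    (hf : IsInvariantLinear f) : IsMultiplicative (mcOneForm f) := by
  refine isMultiplicative_of_apply fun g h x V W X => ?_
  refine (congrArg (fun v => f v x ![]) (maurerCartan_mul (I := I) (E := E) g h (V 0) (W 0))).trans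
    ((DForm.map_add_apply f _ _ x _).trans (congrArg
      (fun a : ℝ => a + f (maurerCartan h (W 0)) x ![]) ?_))
  exact (hf.apply_smul h (maurerCartan g (V 0)) x ![]).symm.trans
    (DForm.congr_vec _ _ fun i => i.elim0)

theorem vanishesOnSlices_mcOneForm (f : GroupLieAlgebra I G →ₗ[ℝ] DForm J M 0) :
    VanishesOnSlices (mcOneForm f) := by
  rw [vanishesOnSlices_iff]
  intro g x X
  refine (congrArg (fun v => f v x ![]) (maurerCartan_zero (I := I) g)).trans ?_
  rw [map_zero]
  rfl

/-- The two-form attached to an exact element of the Cartan complex is a coboundary. -/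
theorem mcTwoForm_eq_of_cartanD₂
    (hc : ((ρs, φ) : CartanCochain₃ I J G M) ∈ cartanCocycles₃ I J G M)
    {b : CartanCochain₂ I J G M} (hb : IsCartanForm₂ b) (h : ∀ v, cartanD₂ b v = (ρs v, φ)) :
    mcTwoForm ρs = simpD₀ I G b.2 - (mcOneForm b.1).d := by
  have hex := hasExplicitFormula_mcTwoForm hc
  have ha := isAssociatedForm_mcTwoForm hc
  have h₁ : DForm.IsSmooth (mcOneForm b.1) := isSmooth_mcOneForm hb.smooth_lin
  refine sub_eq_zero.1 (IsMultiplicative.eq_zero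
    (ha.multiplicative.sub ((isMultiplicative_simpD₀ _).sub
      ((isMultiplicative_mcOneForm hb.inv_lin).d h₁)))
    ((vanishesOnSlices_of_hasExplicitFormula hex).sub ((vanishesOnSlices_simpD₀ hb.inv_const).sub
      ((vanishesOnSlices_mcOneForm b.1).d h₁))) fun x v X => ?_)
  have h₂ := (vanishesOnSlices_mcOneForm b.1).d_apply_prod h₁ 1 x v (b.1 v) (fun x' X => by
    refine (congrArg (fun v => b.1 v x' ![]) (maurerCartan_one (I := I) (E := E) v)).trans ?_
    exact DForm.congr_vec (b.1 v) _ fun i => i.elim0) (hb.smooth_lin v) X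
  have h₃ := simpD₀_apply_unit b.2 x v X
  have h₄ : mcTwoForm ρs (1, x) (Matrix.vecCons (pairVec (I := I) (g := 1) v 0)
      (fun i => pairVec (I := I) (g := 1) 0 (X i))) = ρs v x X := by
    refine Eq.trans (DForm.congr_vec _ _ fun i => ?_) ((mcTwoForm_apply_unit hex x v (X 0)).trans
      (DForm.congr_vec (ρs v) _ fun i => ?_))
    · fin_cases i <;> rfl
    · fin_cases i; rfl
  -- At units the claimed identity is precisely the form-degree-one component of d_H b = ρ^* + φ.
  have h₅ : ρs v x X = (b.1 v).d x X - DForm.contract (infAction I J v) b.2 x X :=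
    (congrArg (fun A : DForm J M 1 => A x X) (congrArg Prod.fst (h v))).symm
  refine (congrArg₂ (fun a b : ℝ => a - b) (h₄.trans h₅)
    (congrArg₂ (fun a b : ℝ => a - b) h₃ h₂)).trans ?_
  ring

/-! ### The map in cohomology -/

theorem simpD₂_zero : simpD₂ (0 : DForm (I.prod (I.prod J)) (G × G × M) k) = 0 := by
  simpa using simpD₂_smul (0 : ℝ) (0 : DForm (I.prod (I.prod J)) (G × G × M) k)

theorem simpD₃_zero :
    simpD₃ (0 : DForm (I.prod (I.prod (I.prod J))) (G × G × G × M) k) = 0 := by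
  simpa using simpD₃_smul (0 : ℝ) (0 : DForm (I.prod (I.prod (I.prod J))) (G × G × G × M) k)

theorem IsAssociatedForm.mem_totCocycles₃ {θ : DForm (I.prod J) (G × M) 2}
    (hθ : IsAssociatedForm ρs φ θ) (hφ : φ.IsSmooth) (hdφ : φ.d = 0) :
    ((φ, θ, 0, 0) : TotCochain₃ I J G M) ∈ totCocycles₃ I J G M := by
  refine ⟨⟨hφ, hθ.smooth, DForm.isSmooth_zero, DForm.isSmooth_zero⟩, ?_⟩
  have h₁ : simpD₀ I G φ - θ.d = 0 := sub_eq_zero.2 hθ.relClosed.symm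
  have h₂ : simpD₁ θ = 0 := isMultiplicative_iff_simpD₁_eq_zero.1 hθ.multiplicative
  change (φ.d, simpD₀ I G φ - θ.d, simpD₁ θ + DForm.d 0, simpD₂ 0 - DForm.d 0, simpD₃ 0) = 0
  rw [hdφ, h₁, h₂, simpD₂_zero, simpD₃_zero, DForm.d_zero, DForm.d_zero, sub_zero, add_zero]
  rfl

theorem mcTwoForm_add (ρs ρs' : GroupLieAlgebra I G →ₗ[ℝ] DForm J M 1) :
    mcTwoForm (ρs + ρs') = mcTwoForm ρs + mcTwoForm ρs' := by
  funext p
  ext A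
  exact add_sub_add_comm _ _ _ _

theorem mcTwoForm_smul (r : ℝ) (ρs : GroupLieAlgebra I G →ₗ[ℝ] DForm J M 1) :
    mcTwoForm (r • ρs) = r • mcTwoForm ρs := by
  funext p
  ext A
  exact (mul_sub _ _ _).symm

variable (I J G M) in
/-- `ρ^* + φ ↦ ω + φ` on cocycles. -/
def cartanToTot : cartanCocycles₃ I J G M →ₗ[ℝ] totCocycles₃ I J G M where
  toFun c := ⟨(c.1.2, mcTwoForm c.1.1, 0, 0),
    (isAssociatedForm_mcTwoForm c.2).mem_totCocycles₃ c.2.1.smooth_const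
      -- The component dφ of `cartanD₃ c v` does not depend on `v`, so v = 0 serves.
      (congrArg (fun p => p.2.2) (c.2.2 0))⟩
  map_add' c c' := by
    refine Subtype.ext ?_
    refine Prod.ext rfl (Prod.ext (mcTwoForm_add _ _) ?_)
    exact Prod.ext (add_zero _).symm (add_zero _).symm
  map_smul' r c := by
    refine Subtype.ext ?_
    refine Prod.ext rfl (Prod.ext (mcTwoForm_smul _ _) ?_)
    exact Prod.ext (smul_zero _).symm (smul_zero _).symm

/-- A Cartan primitive f + β yields the total primitive (β, f(λ), 0); its component on H² × M
vanishes because f(λ) is multiplicative. -/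
theorem cartanCoboundaries₃_le_comap :
    cartanCoboundaries₃ I J G M ≤ (totCoboundaries₃ I J G M).comap (cartanToTot I J G M) := by
  rintro c ⟨b, hb, h⟩
  refine ⟨(b.2, mcOneForm b.1, 0), ⟨hb.smooth_const, isSmooth_mcOneForm hb.smooth_lin,
    DForm.isSmooth_zero⟩, ?_⟩
  have h₁ : simpD₁ (mcOneForm b.1) = 0 :=
    isMultiplicative_iff_simpD₁_eq_zero.1 (isMultiplicative_mcOneForm hb.inv_lin)
  refine Prod.ext (congrArg Prod.snd (h 0)) (Prod.ext (mcTwoForm_eq_of_cartanD₂ c.2 hb h).symm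
    (Prod.ext ?_ simpD₂_zero))
  change simpD₁ (mcOneForm b.1) + DForm.d 0 = 0
  rw [h₁, DForm.d_zero, add_zero]

end Smooth

end

/-! ### The main theorem -/

theorem mainTheorem5
    {E : Type*} [NormedAddCommGroup E] [NormedSpace ℝ E] [FiniteDimensional ℝ E]
    {K : Type*} [TopologicalSpace K] (I : ModelWithCorners ℝ E K) [I.Boundaryless]
    {F : Type*} [NormedAddCommGroup F] [NormedSpace ℝ F] [FiniteDimensional ℝ F]
    {L : Type*} [TopologicalSpace L] (J : ModelWithCorners ℝ F L) [J.Boundaryless]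
    (G : Type*) [TopologicalSpace G] [ChartedSpace K G] [Group G] [LieGroup I ∞ G]
    [ConnectedSpace G]
    (M : Type*) [TopologicalSpace M] [T2Space M] [ChartedSpace L M] [IsManifold J ∞ M]
    [MulAction G M] [ContMDiffSMul I J ∞ G M] :
    (∀ (ρs : GroupLieAlgebra I G →ₗ[ℝ] DForm J M 1) (φ : DForm J M 3),
      (∀ v, DForm.IsSmooth (ρs v)) → φ.IsSmooth → φ.d = 0 →
      SkewCondition ρs → BracketCondition ρs φ →
      ∀ θ : DForm (I.prod J) (G × M) 2, IsAssociatedForm ρs φ θ →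
        [((ρs, φ) : CartanCochain₃ I J G M) ∈ cartanCocycles₃ I J G M,
          VanishesOnSlices θ,
          HasCompactFormula ρs θ,
          HasExplicitFormula ρs θ].TFAE) ∧
    ∃ Φ : CartanH₃ I J G M →ₗ[ℝ] EquivariantH₃ I J G M,
      ∀ c : cartanCocycles₃ I J G M,
        ∃ θ : DForm (I.prod J) (G × M) 2,
          IsAssociatedForm c.1.1 c.1.2 θ ∧
          (∀ θ', IsAssociatedForm c.1.1 c.1.2 θ' → θ' = θ) ∧
          HasExplicitFormula c.1.1 θ ∧
          ∃ h : ((c.1.2, θ, 0, 0) : TotCochain₃ I J G M) ∈ totCocycles₃ I J G M,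
            Φ (Submodule.Quotient.mk c) = Submodule.Quotient.mk ⟨(c.1.2, θ, 0, 0), h⟩ := by
  refine ⟨fun ρs φ hρ hφ hdφ hskew _ θ hθ => ?_, ?_⟩
  · tfae_have 1 → 2 := fun hc => vanishesOnSlices_of_d_eq_contract hθ hρ
      (d_eq_contract_of_mem_cartanCocycles₃ hc)
    tfae_have 2 → 1 := mem_cartanCocycles₃_of_vanishesOnSlices hθ hρ hφ hdφ hskew
    tfae_have 2 → 4 := hasExplicitFormula_of_vanishesOnSlices hθ
    tfae_have 4 → 2 := vanishesOnSlices_of_hasExplicitFormula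
    tfae_have 3 ↔ 4 := hasCompactFormula_iff_hasExplicitFormula hskew.apply_const
    tfae_finish
  · refine ⟨Submodule.mapQ _ _ (cartanToTot I J G M) cartanCoboundaries₃_le_comap,
      fun c => ⟨mcTwoForm c.1.1, isAssociatedForm_mcTwoForm c.2,
        fun _ hθ' => hθ'.eq_mcTwoForm c.2, hasExplicitFormula_mcTwoForm c.2,
        (cartanToTot I J G M c).2, rfl⟩⟩
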